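/- Let $1\le p<\infty$ and let $X,U,Z$ be complex Banach spaces, $Z\subseteq X$ with dense and continuous embedding. Let $A_m:Z\to X$ be a linear operator which is closed as an operator in $X$ with domain $Z$, and let $G,M\in\mathcal L(Z,U)$ with $G$ surjective. Put $A:=A_m|_{\ker G}$, $A^M:=A_m|_{\ker(G-M)}$, and, for $\lambda\in\rho(A)$, $D_\lambda:=(G|_{\ker(\lambda-A_m)})^{-1}\in\mathcal L(U,Z)$. Assume that $A$ generates a strongly continuous semigroup $(T(t))_{t\ge0}$ on $X$, with extrapolation space $X_{-1}$ and extensions $A_{-1}:X\to X_{-1}$, $T_{-1}(t)$, and let $B:=(\lambda-A_{-1})D_\lambda:U\to X_{-1}$ and $C:=M|_{D(A)}$. Assume that the triple $(A,B,C)$ is regular with feedthrough zero, that is: (a) for some $\tau>0$, $\Phi_\tau u:=\int_0^\tau T_{-1}(\tau-s)Bu(s)\,ds\in X$ for all $u\in L^p([0,\infty),U)$; (b) for some $\tau,\gamma>0$, $\|CT(\cdot)x\|_{L^p([0,\tau],U)}\le\gamma\|x\|$ for all $x\in D(A)$; (c) for every $a>0$ there is $\kappa>0$ with $\|M\Phi_\cdot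 u\|_{L^p([0,a],U)}\le\kappa\|u\|_{L^p([0,a],U)}$ for all $u\in W^{1,p}([0,a],U)$ with $u(0)=0$, so that $u\mapsto M\Phi_\cdot u$ extends to a bounded operator $F_a$ on $L^p([0,a],U)$; (d) $\lim_{t\to0+}\frac1t\int_0^t(F_a v)(s)\,ds=0$ for every constant input $v\in U$. Assume also that $I-F_\tau$ is invertible in $L^p([0,\tau],U)$ for some $\tau>0$. Let $Y:=L^p([-1,0],X)$, $W:=W^{1,p}([-1,0],X)$, and let $\mu:[-1,0]\to\mathcal L(X)$ and $\nu:[-1,0]\to\mathcal L(X,U)$ be of bounded variation, continuous at $0$, with $\mu(0)=0$ and $\nu(0)=0$. For $\varphi\in W$ let $P\varphi:=\int_{-1}^0d\mu(\theta)\varphi(\theta)$ and $L\varphi:=\int_{-1}^0d\nu(\theta)\varphi(\theta)$. On $X\times Y$ consider $$\mathcal A_{P,L}\binom{x}{\varphi}=\binom{A_mx+P\varphi}{\varphi'},\qquad D(\mathcal A_{P,L})=\Big\{\binom x\varphi\in Z\times W:(G-M)x=L\varphi,\ x=\varphi(0)\Big\},$$ and on $Y$ the operator $Q\varphi=\varphi'$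 with $D(Q)=\{\varphi\in W:\varphi(0)=0\}$. For $x\in X$ let $(e_\lambda x)(\theta)=e^{\lambda\theta}x$ for $\theta\in[-1,0]$; in front of a function, $e_{-\lambda}$ denotes multiplication by $\theta\mapsto e^{-\lambda\theta}$. Let $\lambda\in\rho(A)$ and $1\in\rho(D_\lambda M)$ (in $\mathcal L(Z)$). Then $\lambda\in\rho(A^M)$, the operator $D^M_\lambda:=((G-M)|_{\ker(\lambda-A_m)})^{-1}\in\mathcal L(U,Z)$ exists, $D_\lambda^M=(I-D_\lambda M)^{-1}D_\lambda$, for every $u\in U$ the element $z=D^M_\lambda u$ satisfies $(\lambda-A_{-1})z=B(u+Mz)$ in $X_{-1}$ (that is, $D_\lambda^M=R(\lambda,A^M_{-1})B$), and the operator $$\Delta(\lambda):=e_\lambda\big[D_\lambda^ML+R(\lambda,A^M)P\big]=e_\lambda(I-D_\lambda M)^{-1}\big[D_\lambda L+R(\lambda,A)P\big]\in\mathcal L(W)$$ satisfies $$\lambda\in\rho(\mathcal A_{P,L})\iff1\in\rho(\Delta(\lambda)).$$ In this case $\lambda\in\rho(Q)$, and $$R(\lambda,\mathcal A_{P,L})=\begin{pmatrix}R(\lambda)_{11}&R(\lambda)_{12}\\R(\lambda)_{21}&R(\lambda)_{22}\end{pmatrix}$$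 with the bounded operators $$R(\lambda)_{11}=e_{-\lambda}(I-\Delta(\lambda))^{-1}e_\lambda R(\lambda,A^M),\qquad R(\lambda)_{12}=e_{-\lambda}\Delta(\lambda)(I-\Delta(\lambda))^{-1}R(\lambda,Q),$$ $$R(\lambda)_{21}=(I-\Delta(\lambda))^{-1}e_\lambda R(\lambda,A^M),\qquad R(\lambda)_{22}=(I-\Delta(\lambda))^{-1}R(\lambda,Q),$$ where $R(\lambda,Q)$ is regarded as a bounded operator from $Y$ to $W$, and where the values of the right-hand sides of the first line are constant functions on $[-1,0]$, which are identified with elements of $X$. -/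

import Mathlib

open MeasureTheory Set Filter Topology
open scoped ENNReal

namespace BoundaryDelay

noncomputable section

/-! ### Unbounded operators: resolvent set, resolvent, generation of semigroups -/

section Operators

variable {E : Type*} [NormedAddCommGroup E] [NormedSpace ℂ E]

/-- The unbounded operator on `E` whose domain is the image of `j : D → E` and which acts by
`j d ↦ a d` (for injective `j`; it is given through its graph `{(j d, a d) : d ∈ D}`). -/
def opOn {D : Type*} [AddCommGroup D] [Module ℂ D] (j a : D →ₗ[ℂ] E) : E →ₗ.[ℂ] E :=
  (LinearMap.range (j.prod a)).toLinearPMap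

/-- `R` is a bounded everywhere defined two-sided inverse of `lam - A : D(A) → E`. -/
def IsResolventAt (A : E →ₗ.[ℂ] E) (lam : ℂ) (R : E →L[ℂ] E) : Prop :=
  (∀ x : A.domain, R (lam • (x : E) - A x) = x) ∧
    ∀ y : E, ∃ x : A.domain, (x : E) = R y ∧ lam • (x : E) - A x = y

/-- The resolvent set `ρ(A)` of an unbounded operator. -/
def rho (A : E →ₗ.[ℂ] E) : Set ℂ := {lam | ∃ R : E →L[ℂ] E, IsResolventAt A lam R}

open Classical in
/-- The resolvent `R(lam, A) = (lam - A)⁻¹` (and `0` if `lam ∉ ρ(A)`). -/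
def res (A : E →ₗ.[ℂ] E) (lam : ℂ) : E →L[ℂ] E :=
  if h : ∃ R : E →L[ℂ] E, IsResolventAt A lam R then h.choose else 0

/-- Strongly continuous semigroups `(T t)_{t ≥ 0}`; the values at `t < 0` are irrelevant. -/
structure IsC0Semigroup (T : ℝ → E →L[ℂ] E) : Prop where
  zero : T 0 = 1
  add : ∀ s t : ℝ, 0 ≤ s → 0 ≤ t → T (s + t) = T s ∘L T t
  continuousOn : ∀ x : E, ContinuousOn (fun t => T t x) (Ici 0)

/-- `A` is the generator of `T`: `A x = y` exactly if `(T t x - x) / t → y` as `t → 0+`. -/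
def IsGeneratorOf (A : E →ₗ.[ℂ] E) (T : ℝ → E →L[ℂ] E) : Prop :=
  ∀ x y : E, (x, y) ∈ A.graph ↔
    Tendsto (fun t : ℝ => t⁻¹ • (T t x - x)) (𝓝[>] 0) (𝓝 y)

end Operators

/-! ### The extrapolation space -/

section Extrapolation

variable {X : Type*} [NormedAddCommGroup X] [NormedSpace ℂ X]

/-- The space `X` with the norm `‖x‖₋₁ = ‖R(α, A) x‖`. -/
@[nolint unusedArguments]
def PreExtrap (_A : X →ₗ.[ℂ] X) (_α : ℂ) : Type _ := X

variable (A : X →ₗ.[ℂ] X) (α : ℂ)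

instance : AddCommGroup (PreExtrap A α) := inferInstanceAs (AddCommGroup X)

instance : Module ℂ (PreExtrap A α) := inferInstanceAs (Module ℂ X)

/-- `R(α, A)` as a linear map on the renamed space. -/
def PreExtrap.resLin : PreExtrap A α →ₗ[ℂ] X := (res A α : X →ₗ[ℂ] X)

instance : SeminormedAddCommGroup (PreExtrap A α) :=
  SeminormedAddCommGroup.induced (PreExtrap A α) X (PreExtrap.resLin A α)

instance : NormedSpace ℂ (PreExtrap A α) :=
  NormedSpace.induced ℂ (PreExtrap A α) X (PreExtrap.resLin A α)

/-- The extrapolation space `X₋₁`: the completion of `X` for `‖·‖₋₁`. -/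
abbrev Extrap : Type _ := UniformSpace.Completion (PreExtrap A α)

/-- The embedding `X → X₋₁`. -/
def toExtrap (x : X) : Extrap A α := ((show PreExtrap A α from x) : Extrap A α)

/-- `A₋₁ : X → X₋₁`, the extension of `A` from `D(A)` to `X` by continuity. -/
def extrapOp (x : X) : Extrap A α :=
  limUnder (Filter.comap (Subtype.val : A.domain → X) (𝓝 x)) fun a => toExtrap A α (A a)

/-- The extension of a bounded operator `S` on `X` to `X₋₁` by continuity (it is used for
`S = T t`, which commutes with `R(α, A)`). -/
def extrapMap (S : X →L[ℂ] X) : Extrap A α → Extrap A α :=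
  UniformSpace.Completion.map fun x : PreExtrap A α =>
    (show PreExtrap A α from S (show X from x))

end Extrapolation

/-! ### Boundary systems `ι : Z ↪ X`, `Am : Z → X`, `G, M : Z → U` -/

section Boundary

variable {X U Z : Type*} [NormedAddCommGroup X] [NormedSpace ℂ X]
  [NormedAddCommGroup U] [NormedSpace ℂ U] [NormedAddCommGroup Z] [NormedSpace ℂ Z]

/-- The restriction of `Am` to `ker Γ`, as an unbounded operator on `X`. With `Γ = G` this is
`A`, with `Γ = G - M` it is `A^M`. -/
def bdryOp (ι : Z →L[ℂ] X) (Am : Z →ₗ[ℂ] X) (Γ : Z →L[ℂ] U) : X →ₗ.[ℂ] X :=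
  opOn (D := LinearMap.ker (Γ : Z →ₗ[ℂ] U))
    ((ι : Z →ₗ[ℂ] X) ∘ₗ (LinearMap.ker (Γ : Z →ₗ[ℂ] U)).subtype)
    (Am ∘ₗ (LinearMap.ker (Γ : Z →ₗ[ℂ] U)).subtype)

/-- `D` is the inverse of the restriction of `Γ` to `ker (lam - Am)`. -/
def IsDirichlet (ι : Z →L[ℂ] X) (Am : Z →ₗ[ℂ] X) (Γ : Z →L[ℂ] U) (lam : ℂ)
    (D : U →L[ℂ] Z) : Prop :=
  (∀ u : U, Am (D u) = lam • ι (D u) ∧ Γ (D u) = u) ∧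
    ∀ z : Z, Am z = lam • ι z → D (Γ z) = z

open Classical in
/-- The Dirichlet operator `(Γ|ker (lam - Am))⁻¹ ∈ L(U, Z)` (and `0` if there is none). With
`Γ = G` this is `D_lam = R(lam, A₋₁) B`. With `Γ = G - M` it is `D_lam^M = R(lam, A^M₋₁) B`: here
`Am = A^M₋₁ + B (G - M)` on `Z`, so that `(lam - A^M₋₁) z = B u` for `z ∈ Z` says
`lam z - Am z = B (u - (G - M) z)`, that is, `Am z = lam z` and `(G - M) z = u`. -/
def dirichletOp (ι : Z →L[ℂ] X) (Am : Z →ₗ[ℂ] X) (Γ : Z →L[ℂ] U) (lam : ℂ) : U →L[ℂ] Z :=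
  if h : ∃ D : U →L[ℂ] Z, IsDirichlet ι Am Γ lam D then h.choose else 0

/-- The control operator `B = (α - A₋₁) D_α : U → X₋₁`, where `A = Am|ker G`. -/
def controlOp (ι : Z →L[ℂ] X) (Am : Z →ₗ[ℂ] X) (G : Z →L[ℂ] U) (α : ℂ) (u : U) :
    Extrap (bdryOp ι Am G) α :=
  α • toExtrap (bdryOp ι Am G) α (ι (dirichletOp ι Am G α u)) -
    extrapOp (bdryOp ι Am G) α (ι (dirichletOp ι Am G α u))

/-- The control map `Φ_t u = ∫_0^t T₋₁(t - s) B u(s) ds ∈ X₋₁`. -/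
def controlMap (ι : Z →L[ℂ] X) (Am : Z →ₗ[ℂ] X) (G : Z →L[ℂ] U) (α : ℂ)
    (T : ℝ → X →L[ℂ] X) (t : ℝ) (u : ℝ → U) : Extrap (bdryOp ι Am G) α :=
  ∫ s in (0 : ℝ)..t, extrapMap (bdryOp ι Am G) α (T (t - s)) (controlOp ι Am G α (u s))

/-- `p`-admissibility of the control operator: `Φ_τ u ∈ X` for all `u ∈ L^p([0,∞), U)`, for some
`τ > 0`. -/
def AdmissibleControl (p : ℝ≥0∞) (ι : Z →L[ℂ] X) (Am : Z →ₗ[ℂ] X) (G : Z →L[ℂ] U) (α : ℂ)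
    (T : ℝ → X →L[ℂ] X) : Prop :=
  ∃ τ : ℝ, 0 < τ ∧ ∀ u : ℝ → U, MemLp u p (volume.restrict (Ici 0)) →
    ∃ x : X, toExtrap (bdryOp ι Am G) α x = controlMap ι Am G α T τ u

/-- `M x` for those `x ∈ X` that lie in `Z`. -/
def onZ (ι : Z →L[ℂ] X) (M : Z →L[ℂ] U) (x : X) : U := M (Function.invFun ι x)

/-- `p`-admissibility of the observation operator `C = M|D(A)`. -/
def AdmissibleObservation (p : ℝ≥0∞) (ι : Z →L[ℂ] X) (Am : Z →ₗ[ℂ] X) (G M : Z →L[ℂ] U)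
    (T : ℝ → X →L[ℂ] X) : Prop :=
  ∃ τ : ℝ, 0 < τ ∧ ∃ γ : ℝ, 0 < γ ∧ ∀ x ∈ (bdryOp ι Am G).domain,
    eLpNorm (fun t => onZ ι M (T t x)) p (volume.restrict (Icc 0 τ)) ≤ ENNReal.ofReal (γ * ‖x‖)

/-- The input-output map `t ↦ M Φ_t u`; it is used where `Φ_t u` lies in `Z ⊆ X ⊆ X₋₁`. -/
def ioMap (ι : Z →L[ℂ] X) (Am : Z →ₗ[ℂ] X) (G M : Z →L[ℂ] U) (α : ℂ)
    (T : ℝ → X →L[ℂ] X) (u : ℝ → U) (t : ℝ) : U :=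
  M (Function.invFun (fun z : Z => toExtrap (bdryOp ι Am G) α (ι z))
    (controlMap ι Am G α T t u))

/-- `u ∈ W^{1,p}([0,a], U)` with `u(0) = 0`: `u` is the primitive, vanishing at `0`, of a function
in `L^p`. -/
def IsW0 (p : ℝ≥0∞) (a : ℝ) (u : Lp U p (volume.restrict (Icc 0 a))) : Prop :=
  ∃ v : Lp U p (volume.restrict (Icc 0 a)),
    ∀ᵐ t ∂(volume.restrict (Icc 0 a)), u t = ∫ s in (0 : ℝ)..t, v s

/-- `F ∈ L(L^p([0,a], U))` is the continuous extension of the input-output map `u ↦ M Φ_· u`,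
which is defined on `{u ∈ W^{1,p}([0,a], U) : u(0) = 0}`. -/
def IsIOOperator (p : ℝ≥0∞) [Fact (1 ≤ p)] (ι : Z →L[ℂ] X) (Am : Z →ₗ[ℂ] X)
    (G M : Z →L[ℂ] U) (α : ℂ) (T : ℝ → X →L[ℂ] X) (a : ℝ)
    (F : Lp U p (volume.restrict (Icc 0 a)) →L[ℂ] Lp U p (volume.restrict (Icc 0 a))) : Prop :=
  ∀ u, IsW0 p a u → F u =ᵐ[volume.restrict (Icc 0 a)] ioMap ι Am G M α T u

/-- The triple `(A, B, C)` is well-posed. -/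
structure WellPosedTriple (p : ℝ≥0∞) (ι : Z →L[ℂ] X) (Am : Z →ₗ[ℂ] X)
    (G M : Z →L[ℂ] U) (α : ℂ) (T : ℝ → X →L[ℂ] X) : Prop where
  control : AdmissibleControl p ι Am G α T
  observation : AdmissibleObservation p ι Am G M T
  estimate : ∀ a : ℝ, 0 < a → ∃ κ : ℝ, 0 < κ ∧
    ∀ u : Lp U p (volume.restrict (Icc 0 a)), IsW0 p a u →
      eLpNorm (ioMap ι Am G M α T u) p (volume.restrict (Icc 0 a)) ≤ ENNReal.ofReal (κ * ‖u‖)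

/-- The triple `(A, B, C)` is regular with feedthrough zero. -/
structure RegularTriple (p : ℝ≥0∞) [Fact (1 ≤ p)] (ι : Z →L[ℂ] X) (Am : Z →ₗ[ℂ] X)
    (G M : Z →L[ℂ] U) (α : ℂ) (T : ℝ → X →L[ℂ] X) : Prop
    extends WellPosedTriple p ι Am G M α T where
  regular : ∀ a : ℝ, 0 < a → ∃ F, IsIOOperator p ι Am G M α T a F ∧ ∀ v : U,
    Tendsto (fun t : ℝ => t⁻¹ • ∫ s in (0 : ℝ)..t,
      F (Lp.const p (volume.restrict (Icc 0 a)) v) s) (𝓝[>] 0) (𝓝 0)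

/-- The standing assumptions: `Z` is densely and continuously embedded in `X`, `Am` is a closed
operator on `X` with domain `Z`, the boundary operator `G` is onto, `A = Am|ker G` generates a
strongly continuous semigroup, the triple `(A, B, C)` with `B = (α - A₋₁) D_α` and `C = M|D(A)` is
regular, and `I - F_τ` is invertible in `L^p([0,τ], U)` for some `τ > 0`. -/
structure StandingAssumption (p : ℝ≥0∞) [Fact (1 ≤ p)] (ι : Z →L[ℂ] X) (Am : Z →ₗ[ℂ] X)
    (G M : Z →L[ℂ] U) : Prop where
  embedding : Function.Injective ι
  dense : DenseRange ι
  closed : IsClosed (range fun z : Z => (ι z, Am z))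
  surjective : Function.Surjective G
  regular : ∃ T : ℝ → X →L[ℂ] X, IsC0Semigroup T ∧ IsGeneratorOf (bdryOp ι Am G) T ∧
    ∃ α ∈ rho (bdryOp ι Am G), RegularTriple p ι Am G M α T ∧
      ∃ τ : ℝ, 0 < τ ∧ ∃ F, IsIOOperator p ι Am G M α T τ F ∧ IsUnit (1 - F)

end Boundary

/-! ### History spaces on `[-1, 0]` -/

section History

/-- The interval `[-1, 0]`. -/
abbrev HistI : Type := Set.Icc (-1 : ℝ) 0

/-- The point `0` of `[-1, 0]`. -/
def zeroPt : HistI := ⟨0, by norm_num⟩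

instance : CompactIccSpace HistI := ⟨fun {_ _} => isClosed_Icc.isCompact⟩

/-- The space `Y = L^p([-1,0], X)`. -/
abbrev HistLp (p : ℝ≥0∞) (X : Type*) [NormedAddCommGroup X] : Type _ :=
  Lp X p (volume.restrict (Icc (-1 : ℝ) 0))

variable {X U : Type*} [NormedAddCommGroup X] [NormedSpace ℂ X]
  [NormedAddCommGroup U] [NormedSpace ℂ U]

theorem HistLp.intervalIntegrable {X : Type*} [NormedAddCommGroup X] {p : ℝ≥0∞}
    [hp : Fact (1 ≤ p)] (v : HistLp p X) (θ : HistI) :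
    IntervalIntegrable (fun s => v s) volume 0 θ := by
  have h : IntegrableOn (fun s => v s) (Icc (-1 : ℝ) 0) volume :=
    (Lp.memLp v).integrable hp.out
  rw [intervalIntegrable_iff]
  refine h.mono_set ?_
  rw [uIoc_of_ge θ.2.2]
  exact Ioc_subset_Icc_self.trans (Icc_subset_Icc_left θ.2.1)

/-- The Sobolev space `W = W^{1,p}([-1,0], X)`: pairs `(φ, φ')` of a continuous function `φ` and a
`φ' ∈ L^p([-1,0], X)` with `φ(θ) = φ(0) + ∫_0^θ φ'(s) ds`. The norm `max (‖φ‖_∞, ‖φ'‖_p)` is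
equivalent to the usual one. -/
def W1p (p : ℝ≥0∞) [Fact (1 ≤ p)] (X : Type*) [NormedAddCommGroup X] [NormedSpace ℂ X] :
    Submodule ℂ (C(HistI, X) × HistLp p X) where
  carrier := {w | ∀ θ : HistI, w.1 θ = w.1 zeroPt + ∫ s in (0 : ℝ)..θ, w.2 s}
  zero_mem' := by
    intro θ
    have h : ∫ s in (0 : ℝ)..θ, (0 : HistLp p X) s = ∫ s in (0 : ℝ)..θ, (0 : X) := by
      apply intervalIntegral.integral_congr_ae_restrict
      rw [uIoc_of_ge θ.2.2]
      exact ae_restrict_of_ae_restrict_of_subset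
        (Ioc_subset_Icc_self.trans (Icc_subset_Icc_left θ.2.1)) (Lp.coeFn_zero _ _ _)
    simpa using h.symm
  add_mem' := by
    intro a b ha hb θ
    have h : ∫ s in (0 : ℝ)..θ, (a.2 + b.2) s = ∫ s in (0 : ℝ)..θ, (a.2 s + b.2 s) := by
      apply intervalIntegral.integral_congr_ae_restrict
      rw [uIoc_of_ge θ.2.2]
      exact ae_restrict_of_ae_restrict_of_subset
        (Ioc_subset_Icc_self.trans (Icc_subset_Icc_left θ.2.1)) (Lp.coeFn_add _ _)
    simp only [Prod.fst_add, Prod.snd_add, ContinuousMap.add_apply]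
    rw [h, intervalIntegral.integral_add (HistLp.intervalIntegrable _ θ)
      (HistLp.intervalIntegrable _ θ), ha θ, hb θ]
    abel
  smul_mem' := by
    intro c a ha θ
    have h : ∫ s in (0 : ℝ)..θ, (c • a.2) s = ∫ s in (0 : ℝ)..θ, c • a.2 s := by
      apply intervalIntegral.integral_congr_ae_restrict
      rw [uIoc_of_ge θ.2.2]
      exact ae_restrict_of_ae_restrict_of_subset
        (Ioc_subset_Icc_self.trans (Icc_subset_Icc_left θ.2.1)) (Lp.coeFn_smul _ _)
    simp only [Prod.smul_fst, Prod.smul_snd, ContinuousMap.smul_apply]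
    rw [h, intervalIntegral.integral_smul, ha θ, smul_add]

theorem memLp_extend {X : Type*} [NormedAddCommGroup X] (p : ℝ≥0∞) (f : C(HistI, X)) :
    MemLp (fun s : ℝ => f (projIcc (-1) 0 (by norm_num) s)) p
      (volume.restrict (Icc (-1 : ℝ) 0)) :=
  MemLp.of_bound (f.continuous.comp continuous_projIcc).aestronglyMeasurable ‖f‖
    (Eventually.of_forall fun _ => f.norm_coe_le_norm _)

/-- A continuous function on `[-1, 0]` as an element of `Y`. -/
def toHistLp (p : ℝ≥0∞) [Fact (1 ≤ p)] : C(HistI, X) →ₗ[ℂ] HistLp p X where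
  toFun f := (memLp_extend p f).toLp _
  map_add' _ _ := rfl
  map_smul' _ _ := rfl

/-- The embedding `W → Y`. -/
def W1p.toLp {p : ℝ≥0∞} [Fact (1 ≤ p)] : W1p p X →ₗ[ℂ] HistLp p X :=
  toHistLp p ∘ₗ LinearMap.fst ℂ _ _ ∘ₗ (W1p p X).subtype

/-- The derivative `W → Y`. -/
def W1p.deriv {p : ℝ≥0∞} [Fact (1 ≤ p)] : W1p p X →ₗ[ℂ] HistLp p X :=
  LinearMap.snd ℂ _ _ ∘ₗ (W1p p X).subtype

/-- The value of `φ ∈ W` at a point of `[-1, 0]`. -/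
def W1p.eval {p : ℝ≥0∞} [Fact (1 ≤ p)] (θ : HistI) : W1p p X →ₗ[ℂ] X where
  toFun φ := φ.1.1 θ
  map_add' _ _ := rfl
  map_smul' _ _ := rfl

/-- The function `θ ↦ e^{lam θ} x` on `[-1, 0]`. -/
def expFun (lam : ℂ) (x : X) : C(HistI, X) where
  toFun θ := Complex.exp (lam * ((θ : ℝ) : ℂ)) • x
  continuous_toFun := by fun_prop

theorem expFun_mem (p : ℝ≥0∞) [Fact (1 ≤ p)] [CompleteSpace X] (lam : ℂ) (x : X) :
    (expFun lam x, lam • toHistLp p (expFun lam x)) ∈ W1p p X := by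
  intro θ
  have h : ∫ s in (0 : ℝ)..θ, (lam • toHistLp p (expFun lam x)) s =
      ∫ s in (0 : ℝ)..θ, (lam * Complex.exp (lam * (s : ℂ))) • x := by
    apply intervalIntegral.integral_congr_ae_restrict
    rw [uIoc_of_ge θ.2.2]
    have hsub : Ioc (θ : ℝ) 0 ⊆ Icc (-1) 0 :=
      Ioc_subset_Icc_self.trans (Icc_subset_Icc_left θ.2.1)
    filter_upwards [ae_restrict_of_ae_restrict_of_subset hsub
        (Lp.coeFn_smul lam (toHistLp p (expFun lam x))),
      ae_restrict_of_ae_restrict_of_subset hsub (memLp_extend p (expFun lam x)).coeFn_toLp,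
      ae_restrict_mem measurableSet_Ioc] with s h1 h2 hs
    rw [h1, Pi.smul_apply]
    change lam • (memLp_extend p (expFun lam x)).toLp _ s = _
    rw [h2, projIcc_of_mem _ (hsub hs), mul_smul]
    rfl
  have h' : ∫ s in (0 : ℝ)..θ, (lam * Complex.exp (lam * (s : ℂ))) • x =
      Complex.exp (lam * ((θ : ℝ) : ℂ)) • x - Complex.exp (lam * ((0 : ℝ) : ℂ)) • x := by
    apply intervalIntegral.integral_eq_sub_of_hasDerivAt
      (f := fun s : ℝ => Complex.exp (lam * (s : ℂ)) • x)
    · intro s _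
      have h1 : HasDerivAt (fun s : ℝ => lam * (s : ℂ)) lam s := by
        simpa using (Complex.ofRealCLM.hasDerivAt (x := s)).const_mul lam
      have h2 := h1.cexp.smul_const x
      rwa [mul_comm] at h2
    · exact (by fun_prop : Continuous fun s : ℝ =>
        (lam * Complex.exp (lam * (s : ℂ))) • x).intervalIntegrable _ _
  change Complex.exp (lam * ((θ : ℝ) : ℂ)) • x =
    Complex.exp (lam * ((0 : ℝ) : ℂ)) • x +
      ∫ s in (0 : ℝ)..θ, (lam • toHistLp p (expFun lam x)) s
  rw [h, h']
  abel

theorem norm_toHistLp_le (p : ℝ≥0∞) [Fact (1 ≤ p)] (f : C(HistI, X)) :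
    ‖toHistLp p f‖ ≤ ‖f‖ := by
  have := Lp.norm_le_of_ae_bound (f := toHistLp p f) (norm_nonneg f) (by
    filter_upwards [(memLp_extend p f).coeFn_toLp] with s hs
    change ‖(memLp_extend p f).toLp _ s‖ ≤ _
    rw [hs]
    exact f.norm_coe_le_norm _)
  simpa [measureUnivNNReal] using this

theorem norm_expFun_le (lam : ℂ) (x : X) : ‖expFun lam x‖ ≤ Real.exp ‖lam‖ * ‖x‖ := by
  rw [ContinuousMap.norm_le _ (by positivity)]
  intro θ
  change ‖Complex.exp (lam * ((θ : ℝ) : ℂ)) • x‖ ≤ _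
  rw [norm_smul]
  gcongr
  refine (Complex.norm_exp_le_exp_norm _).trans ?_
  gcongr
  rw [norm_mul, Complex.norm_real]
  have : ‖(θ : ℝ)‖ ≤ 1 := by
    rw [Real.norm_eq_abs, abs_le]; exact ⟨θ.2.1, θ.2.2.trans zero_le_one⟩
  nlinarith [norm_nonneg lam]

/-- The operator `e_lam : X → W`, `(e_lam x)(θ) = e^{lam θ} x`. -/
def expOp (p : ℝ≥0∞) [Fact (1 ≤ p)] [CompleteSpace X] (lam : ℂ) : X →L[ℂ] W1p p X :=
  LinearMap.mkContinuous
    { toFun := fun x => ⟨(expFun lam x, lam • toHistLp p (expFun lam x)), expFun_mem p lam x⟩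
      map_add' := fun x y => by
        have h : expFun lam (x + y) = expFun lam x + expFun lam y := by
          ext θ; exact smul_add _ _ _
        apply Subtype.ext
        simp only [h, map_add, smul_add]
        rfl
      map_smul' := fun c x => by
        have h : expFun lam (c • x) = c • expFun lam x := by
          ext θ; exact smul_comm _ _ _
        apply Subtype.ext
        simp only [h, map_smul, smul_comm lam c]
        rfl }
    ((1 + ‖lam‖) * Real.exp ‖lam‖) (by
      intro x
      have h1 := norm_expFun_le lam x
      have h2 := norm_toHistLp_le p (expFun lam x)
      have h3 : 0 ≤ Real.exp ‖lam‖ * ‖x‖ := by positivity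
      change ‖(expFun lam x, lam • toHistLp p (expFun lam x))‖ ≤ _
      rw [Prod.norm_mk, norm_smul]
      apply max_le
      · nlinarith [norm_nonneg lam]
      · have : ‖lam‖ * ‖toHistLp p (expFun lam x)‖ ≤ ‖lam‖ * (Real.exp ‖lam‖ * ‖x‖) := by
          gcongr; exact h2.trans h1
        nlinarith [norm_nonneg lam])

/-- The operator `Q φ = φ'` on `Y` with domain `{φ ∈ W : φ(0) = 0}`. -/
def shiftGen (p : ℝ≥0∞) [Fact (1 ≤ p)] (X : Type*) [NormedAddCommGroup X] [NormedSpace ℂ X] :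
    HistLp p X →ₗ.[ℂ] HistLp p X :=
  opOn (D := LinearMap.ker (W1p.eval (p := p) (X := X) zeroPt))
    (W1p.toLp ∘ₗ (LinearMap.ker (W1p.eval (p := p) (X := X) zeroPt)).subtype)
    (W1p.deriv ∘ₗ (LinearMap.ker (W1p.eval (p := p) (X := X) zeroPt)).subtype)

/-! ### Delay operators -/

/-- The vector measure of a function of bounded variation on `[-1, 0]` has finite variation. -/
theorem isFiniteMeasure_variation {E : Type*} [NormedAddCommGroup E] [CompleteSpace E]
    {f : HistI → E} (hf : BoundedVariationOn f univ) :
    IsFiniteMeasure hf.vectorMeasure.variation := by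
  let _ : BoundedOrder HistI :=
    { top := zeroPt
      le_top := fun x => x.2.2
      bot := ⟨-1, by norm_num⟩
      bot_le := fun x => x.2.1 }
  let μ := (hf.stieltjesFunctionRightLim ⊥).measure
  have hμ : IsFiniteMeasure μ := by
    apply StieltjesFunction.isFiniteMeasure_of_forall_abs_le
      (C := (eVariationOn f.rightLim univ).toReal) _ (fun x ↦ ?_)
    exact variationOnFromTo.abs_le_eVariationOn hf.rightLim
  let m := AddContent.onIoc f.rightLim
  have A : ∀ s ∈ {s | ∃ u v, u ≤ v ∧ s = Ioc u v}, ‖m s‖ₑ ≤ μ s := by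
    rintro s ⟨u, v, huv, rfl⟩
    rw [AddContent.onIoc_apply huv]
    simp only [μ, StieltjesFunction.measure_Ioc,
      BoundedVariationOn.stieltjesFunctionRightLim_apply]
    rw [← variationOnFromTo.add hf.rightLim.locallyBoundedVariationOn
      (mem_univ ⊥) (mem_univ u) (mem_univ v)]
    simp only [add_sub_cancel_left, variationOnFromTo, huv, ↓reduceIte, univ_inter]
    rw [ENNReal.ofReal_toReal]; swap
    · exact ((eVariationOn.mono _ (subset_univ _)).trans_lt hf.rightLim.lt_top).ne
    rw [← edist_eq_enorm_sub]
    exact eVariationOn.edist_le _ (by grind) (by grind)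
  have B : (inferInstance : MeasurableSpace HistI) =
      MeasurableSpace.generateFrom {s : Set HistI | ∃ u v, u ≤ v ∧ s = Ioc u v} := by
    have : (inferInstance : MeasurableSpace HistI) = borel HistI := BorelSpace.measurable_eq
    rw [this]
    convert! borel_eq_generateFrom_Ioc_le HistI using 2
    grind only
  rcases VectorMeasure.exists_extension_of_isSetSemiring_of_le_measure_of_generateFrom
    IsSetSemiring.Ioc A B with ⟨m', hm', h'm'⟩
  have key : hf.vectorMeasure =
      m' + VectorMeasure.dirac (⊥ : HistI) (hf.vectorMeasure {⊥} - m' {⊥}) := by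
    have hIoc : ∀ u v : HistI, u ≤ v → hf.vectorMeasure (Ioc u v) = m' (Ioc u v) := by
      intro u v huv
      rw [hf.vectorMeasure_Ioc huv, hm' _ ⟨u, v, huv, rfl⟩]
      exact (AddContent.onIoc_apply huv).symm
    apply VectorMeasure.ext_of_generateFrom _ _ B
    · rintro s ⟨u, v, -, rfl⟩ t ⟨u', v', -, rfl⟩ hne
      rw [Ioc_inter_Ioc] at hne ⊢
      exact ⟨_, _, (nonempty_Ioc.1 hne).le, rfl⟩
    · have : (univ : Set HistI) = {⊥} ∪ Ioc ⊥ ⊤ := by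
        ext x
        rcases eq_or_ne x ⊥ with h | h
        · simp [h]
        · simp
      rw [this]
      have hd : Disjoint ({⊥} : Set HistI) (Ioc ⊥ ⊤) := by simp
      rw [VectorMeasure.of_union hd (measurableSet_singleton _) measurableSet_Ioc,
        VectorMeasure.of_union hd (measurableSet_singleton _) measurableSet_Ioc]
      simp only [add_apply]
      rw [VectorMeasure.dirac_apply_of_mem (measurableSet_singleton _) (by simp),
        VectorMeasure.dirac_apply_of_notMem (by simp), hIoc _ _ bot_le]
      abel
    · rintro s ⟨u, v, huv, rfl⟩
      rw [hIoc u v huv]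
      simp only [add_apply]
      rw [VectorMeasure.dirac_apply_of_notMem (by simp)]
      simp
  rw [key]
  have h1 : (m' + VectorMeasure.dirac (⊥ : HistI) (hf.vectorMeasure {⊥} - m' {⊥})).variation
      ≤ μ + (VectorMeasure.dirac (⊥ : HistI) (hf.vectorMeasure {⊥} - m' {⊥})).variation := by
    refine VectorMeasure.variation_add_le.trans ?_
    gcongr
    exact VectorMeasure.variation_le_of_forall_enorm_le (fun s _ => h'm' s)
  exact isFiniteMeasure_of_le _ h1

/-- The pairing `(x, S) ↦ S x` of `X` with `L(X, U)`. -/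
def pairing (X U : Type*) [NormedAddCommGroup X] [NormedSpace ℂ X]
    [NormedAddCommGroup U] [NormedSpace ℂ U] : X →L[ℝ] (X →L[ℂ] U) →L[ℝ] U :=
  (ContinuousLinearMap.apply ℂ U).bilinearRestrictScalars ℝ

theorem integrable_variation [CompleteSpace U] {ν : HistI → X →L[ℂ] U}
    (hν : BoundedVariationOn ν univ) (f : C(HistI, X)) :
    hν.vectorMeasure.Integrable f := by
  have := isFiniteMeasure_variation hν
  exact Integrable.of_bound f.continuous.aestronglyMeasurable ‖f‖
    (Eventually.of_forall f.norm_coe_le_norm)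

set_option maxSynthPendingDepth 4 in
/-- The Stieltjes integral `f ↦ ∫_{-1}^0 dν(θ) f(θ)` of continuous functions against an
operator-valued function `ν : [-1,0] → L(X, U)` of bounded variation. -/
def stieltjes [CompleteSpace U] (ν : HistI → X →L[ℂ] U) (hν : BoundedVariationOn ν univ) :
    C(HistI, X) →L[ℂ] U :=
  LinearMap.mkContinuous
    { toFun := fun f => hν.vectorMeasure.integral (fun θ => f θ) (pairing X U)
      map_add' := fun f g => VectorMeasure.integral_fun_add (integrable_variation hν f)
        (integrable_variation hν g)
      map_smul' := fun c f => by
        have hf := integrable_variation hν f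
        have h1 := VectorMeasure.integral_continuousLinearMap_comp (B := pairing X U)
          (C := (c • ContinuousLinearMap.id ℂ X).restrictScalars ℝ) hf
        have h2 := VectorMeasure.continuousLinearMap_apply_integral (B := pairing X U)
          (C := (c • ContinuousLinearMap.id ℂ U).restrictScalars ℝ) hf
        have h3 : (pairing X U) ∘L (c • ContinuousLinearMap.id ℂ X).restrictScalars ℝ =
            ((ContinuousLinearMap.compL ℝ (X →L[ℂ] U) U U
              ((c • ContinuousLinearMap.id ℂ U).restrictScalars ℝ)) ∘L pairing X U) := by
          ext x S
          simp [pairing]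
        rw [← h3] at h2
        exact h1.trans h2.symm }
    (‖pairing X U‖ * hν.vectorMeasure.variation.real univ) (by
      have := isFiniteMeasure_variation hν
      intro f
      change ‖hν.vectorMeasure.integral (fun θ => f θ) (pairing X U)‖ ≤ _
      refine VectorMeasure.norm_integral_le_integral_norm.trans ?_
      rw [mul_assoc]
      gcongr
      have h := integral_mono (μ := hν.vectorMeasure.variation) (integrable_variation hν f).norm
        (integrable_const ‖f‖) (fun θ => f.norm_coe_le_norm θ)
      simpa using h)

/-- The delay operator `W → U`, `φ ↦ ∫_{-1}^0 dν(θ) φ(θ)`. -/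
def delayOp (p : ℝ≥0∞) [Fact (1 ≤ p)] [CompleteSpace U] (ν : HistI → X →L[ℂ] U)
    (hν : BoundedVariationOn ν univ) : W1p p X →L[ℂ] U :=
  stieltjes ν hν ∘L ContinuousLinearMap.fst ℂ _ _ ∘L (W1p p X).subtypeL

end History

/-! ### The delay operator matrix -/

section Delay

variable {X U Z : Type*} [NormedAddCommGroup X] [NormedSpace ℂ X]
  [NormedAddCommGroup U] [NormedSpace ℂ U] [NormedAddCommGroup Z] [NormedSpace ℂ Z]

/-- The domain `{(z, φ) ∈ Z × W : (G - M) z = L φ, z = φ(0)}`. -/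
def delayDomain {p : ℝ≥0∞} [Fact (1 ≤ p)] (ι : Z →L[ℂ] X) (G M : Z →L[ℂ] U)
    (L : W1p p X →L[ℂ] U) : Submodule ℂ (Z × W1p p X) where
  carrier := {w | (G - M) w.1 = L w.2 ∧ ι w.1 = W1p.eval zeroPt w.2}
  zero_mem' := by simp
  add_mem' := by
    rintro a b ⟨h1, h2⟩ ⟨h3, h4⟩
    exact ⟨by simp only [Prod.fst_add, Prod.snd_add, map_add, h1, h3],
      by simp only [Prod.fst_add, Prod.snd_add, map_add, h2, h4]⟩
  smul_mem' := by
    rintro c a ⟨h1, h2⟩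
    exact ⟨by simp only [Prod.smul_fst, Prod.smul_snd, map_smul, h1],
      by simp only [Prod.smul_fst, Prod.smul_snd, map_smul, h2]⟩

/-- The operator `𝒜_{P,L} (z, φ) = (Am z + P φ, φ')` on `X × Y`. (The maximum norm that `X × Y`
carries here is equivalent to the sum norm.) -/
def delayMatrix {p : ℝ≥0∞} [Fact (1 ≤ p)] (ι : Z →L[ℂ] X) (Am : Z →ₗ[ℂ] X)
    (G M : Z →L[ℂ] U) (P : W1p p X →L[ℂ] X) (L : W1p p X →L[ℂ] U) :
    (X × HistLp p X) →ₗ.[ℂ] (X × HistLp p X) :=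
  opOn (D := delayDomain ι G M L)
    (((ι : Z →ₗ[ℂ] X).prodMap W1p.toLp) ∘ₗ (delayDomain ι G M L).subtype)
    (((Am.coprod (P : W1p p X →ₗ[ℂ] X)).prod (W1p.deriv ∘ₗ LinearMap.snd ℂ Z (W1p p X))) ∘ₗ
      (delayDomain ι G M L).subtype)

/-- The characteristic operator `Δ(lam) = e_lam [D_lam^M L + R(lam, A^M) P]` on `W`. -/
def charOp {p : ℝ≥0∞} [Fact (1 ≤ p)] [CompleteSpace X] (ι : Z →L[ℂ] X) (Am : Z →ₗ[ℂ] X)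
    (G M : Z →L[ℂ] U) (P : W1p p X →L[ℂ] X) (L : W1p p X →L[ℂ] U) (lam : ℂ) :
    W1p p X →L[ℂ] W1p p X :=
  expOp p lam ∘L
    (ι ∘L dirichletOp ι Am (G - M) lam ∘L L + res (bdryOp ι Am (G - M)) lam ∘L P)

end Delay

end

end BoundaryDelay

open BoundaryDelay

/-! The equation `(lam - 𝒜)(z, φ) = (x, ψ)` is reduced to one equation in `W`. Put `J = (1 - D
M)⁻¹`. Solving the boundary value problem with boundary operator `G - M` by a fixed point equation
in `Z` shows that `J S` and `J D` are its resolvent and its Dirichlet operator, where `S` is the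
resolvent of `A` taken into `Z`. On the history side, `φ` is determined by `φ(0)` and `lam φ - φ'`,
through `e_lam` and the resolvent `RQ` of `Q`. Coupling the two by `z = φ(0)` turns the system into
`z = J S (x + P φ) + J D (L φ)` and `(1 - Δ) φ = e_lam J S x + RQ ψ` (`delay_eq_iff`). If `1 - Δ` is
invertible, this yields the resolvent and its four entries (`isResolventAt_delayResolvent`).

The converse is harder (`isUnit_one_sub_of_isResolventAt`). Injectivity of `1 - Δ` is immediate from
the reduction. For surjectivity, the right-hand sides above have their value at `0` in `D(A^M)`, so
they need not exhaust `W`. For a general `f`, one writes the solution as `f + η`; then `η` has to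
solve the delay problem with the inhomogeneous boundary condition `(G - M) z - L η = L f`. A steep
exponential `h(θ) = e^{nθ} D^M v` absorbs this inhomogeneity: since `ν` has no jump at `0`, `L e_n →
0` in norm (`tendsto_norm_delayOp_comp_expOp`), so `v - L e_n D^M v = L f` is solvable by a Neumann
series for large `n`. The remainder `η - h` satisfies the homogeneous condition and is supplied by
the resolvent of `𝒜`. -/

namespace BoundaryDelay

/-! ### Resolvents of operators given by a parametrized graph. -/

section Operators

variable {E : Type*} [NormedAddCommGroup E] [NormedSpace ℂ E]

theorem mem_graph_opOn {D : Type*} [AddCommGroup D] [Module ℂ D] {j a : D →ₗ[ℂ] E}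
    (hj : Function.Injective j) {x y : E} :
    (x, y) ∈ (opOn j a).graph ↔ ∃ d, j d = x ∧ a d = y := by
  rw [opOn, Submodule.toLinearPMap_graph_eq]
  · simp [LinearMap.mem_range, Prod.ext_iff]
  · rintro _ ⟨d, rfl⟩ h
    have : d = 0 := hj (by simpa using h)
    simp [this]

/-- Injectivity of `j` lets elements of the domain be replaced by their parameters `d`; this serves
`bdryOp`, `shiftGen` and `delayMatrix` alike. -/
theorem isResolventAt_opOn_iff {D : Type*} [AddCommGroup D] [Module ℂ D] {j a : D →ₗ[ℂ] E}
    (hj : Function.Injective j) {lam : ℂ} {R : E →L[ℂ] E} :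
    IsResolventAt (opOn j a) lam R ↔
      (∀ d, R (lam • j d - a d) = j d) ∧ ∀ y, ∃ d, j d = R y ∧ lam • j d - a d = y := by
  constructor
  · rintro ⟨h1, h2⟩
    refine ⟨fun d => ?_, fun y => ?_⟩
    · obtain ⟨x, hx, hx'⟩ := (LinearPMap.mem_graph_iff _).1
        ((mem_graph_opOn hj).2 ⟨d, rfl, rfl⟩ : (j d, a d) ∈ (opOn j a).graph)
      have := h1 x
      rwa [hx', hx] at this
    · obtain ⟨x, hx, hx'⟩ := h2 y
      obtain ⟨d, hd, hd'⟩ := (mem_graph_opOn hj).1 ((opOn j a).mem_graph x)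
      exact ⟨d, hd.trans hx, by rw [hd, hd', hx']⟩
  · rintro ⟨h1, h2⟩
    refine ⟨fun x => ?_, fun y => ?_⟩
    · obtain ⟨d, hd, hd'⟩ := (mem_graph_opOn hj).1 ((opOn j a).mem_graph x)
      rw [← hd, ← hd', h1]
    · obtain ⟨d, hd, hd'⟩ := h2 y
      obtain ⟨x, hx, hx'⟩ := (LinearPMap.mem_graph_iff _).1
        ((mem_graph_opOn hj).2 ⟨d, rfl, rfl⟩ : (j d, a d) ∈ (opOn j a).graph)
      exact ⟨x, hx.trans hd, by rw [hx, hx', hd']⟩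

theorem IsResolventAt.unique {A : E →ₗ.[ℂ] E} {lam : ℂ} {R R' : E →L[ℂ] E}
    (h : IsResolventAt A lam R) (h' : IsResolventAt A lam R') : R = R' := by
  ext y
  obtain ⟨x, hx, hx'⟩ := h.2 y
  rw [← hx, ← h'.1 x, hx']

theorem IsResolventAt.res_eq {A : E →ₗ.[ℂ] E} {lam : ℂ} {R : E →L[ℂ] E}
    (h : IsResolventAt A lam R) : res A lam = R := by
  have hex : ∃ R : E →L[ℂ] E, IsResolventAt A lam R := ⟨R, h⟩
  rw [res, dif_pos hex]
  exact hex.choose_spec.unique h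

end Operators

/-! ### Boundary value problems for `lam - Am` and their perturbation by `M`. -/

section Boundary

variable {X U Z : Type*} [NormedAddCommGroup X] [NormedSpace ℂ X]
  [NormedAddCommGroup U] [NormedSpace ℂ U] [NormedAddCommGroup Z] [NormedSpace ℂ Z]
  {ι : Z →L[ℂ] X} {Am : Z →ₗ[ℂ] X} {Γ G M : Z →L[ℂ] U} {lam : ℂ}

/-- `S` is the inverse of `lam - Am|ker Γ`, as an operator into `Z`. -/
def IsBdryResolvent (ι : Z →L[ℂ] X) (Am : Z →ₗ[ℂ] X) (Γ : Z →L[ℂ] U) (lam : ℂ)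
    (S : X →L[ℂ] Z) : Prop :=
  (∀ z, Γ z = 0 → S (lam • ι z - Am z) = z) ∧
    ∀ x, Γ (S x) = 0 ∧ lam • ι (S x) - Am (S x) = x

theorem isResolventAt_bdryOp_iff (hι : Function.Injective ι) {R : X →L[ℂ] X} :
    IsResolventAt (bdryOp ι Am Γ) lam R ↔
      (∀ z, Γ z = 0 → R (lam • ι z - Am z) = ι z) ∧
        ∀ y, ∃ z, Γ z = 0 ∧ ι z = R y ∧ lam • ι z - Am z = y := by
  rw [bdryOp, isResolventAt_opOn_iff (fun a b h => Subtype.ext (hι h))]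
  simp only [LinearMap.comp_apply, Submodule.subtype_apply, Subtype.forall, Subtype.exists,
    LinearMap.mem_ker, ContinuousLinearMap.coe_coe, exists_prop]

theorem IsBdryResolvent.isResolventAt (hι : Function.Injective ι) {S : X →L[ℂ] Z}
    (hS : IsBdryResolvent ι Am Γ lam S) : IsResolventAt (bdryOp ι Am Γ) lam (ι ∘L S) :=
  (isResolventAt_bdryOp_iff hι).2
    ⟨fun z hz => congrArg ι (hS.1 z hz), fun y => ⟨S y, (hS.2 y).1, rfl, (hS.2 y).2⟩⟩

/-- Closed graph theorem: a limit in `Z` is also a limit in `X`, where `R` is continuous and `ι` is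
injective. Hence resolvents of boundary operators are bounded into `Z`. -/
theorem exists_lift [CompleteSpace X] [CompleteSpace Z] (hι : Function.Injective ι)
    (R : X →L[ℂ] X) (h : ∀ y, ∃ z, ι z = R y) : ∃ S : X →L[ℂ] Z, ∀ y, ι (S y) = R y := by
  choose s hs using h
  let l : X →ₗ[ℂ] Z :=
    { toFun := s
      map_add' := fun x y => hι (by simp [hs])
      map_smul' := fun c x => hι (by simp [hs]) }
  have hl : Continuous l := by
    refine l.continuous_of_seq_closed_graph fun u x y hu hy => hι ?_
    have h1 : Tendsto (fun n => R (u n)) atTop (𝓝 (ι y)) := by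
      exact ((ι.continuous.tendsto y).comp hy).congr fun n => hs (u n)
    exact (tendsto_nhds_unique h1 ((R.continuous.tendsto x).comp hu)).trans (hs x).symm
  exact ⟨⟨l, hl⟩, hs⟩

theorem exists_isBdryResolvent [CompleteSpace X] [CompleteSpace Z] (hι : Function.Injective ι)
    (h : lam ∈ rho (bdryOp ι Am Γ)) : ∃ S, IsBdryResolvent ι Am Γ lam S := by
  obtain ⟨R, hR⟩ := h
  rw [isResolventAt_bdryOp_iff hι] at hR
  obtain ⟨S, hS⟩ := exists_lift hι R fun y => (hR.2 y).imp fun z hz => hz.2.1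
  refine ⟨S, fun z hz => hι ((hS _).trans (hR.1 z hz)), fun x => ?_⟩
  obtain ⟨z, h1, h2, h3⟩ := hR.2 x
  rw [← hS] at h2
  rw [← hι h2]
  exact ⟨h1, h3⟩

/-- Convergence in `Z` implies convergence in `X`, so closedness of `Am` in `X` gives a closed graph
over `Z`, and the closed graph theorem applies. -/
theorem continuous_of_isClosed_range [CompleteSpace X] [CompleteSpace Z]
    (h : IsClosed (range fun z : Z => (ι z, Am z))) (hι : Function.Injective ι) :
    Continuous Am := by
  refine Am.continuous_of_seq_closed_graph fun u x y hu hy => ?_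
  obtain ⟨z, hz⟩ := h.mem_of_tendsto (((ι.continuous.tendsto x).comp hu).prodMk_nhds hy)
    (Eventually.of_forall fun n => ⟨u n, rfl⟩)
  simp only [Prod.mk.injEq] at hz
  rw [← hz.2, hι hz.1]

theorem IsDirichlet.unique {D D' : U →L[ℂ] Z} (h : IsDirichlet ι Am Γ lam D)
    (h' : IsDirichlet ι Am Γ lam D') : D = D' := by
  ext u
  rw [← h'.2 (D u) (h.1 u).1, (h.1 u).2]

theorem IsDirichlet.dirichletOp_eq {D : U →L[ℂ] Z} (h : IsDirichlet ι Am Γ lam D) :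
    dirichletOp ι Am Γ lam = D := by
  have hex : ∃ D : U →L[ℂ] Z, IsDirichlet ι Am Γ lam D := ⟨D, h⟩
  rw [dirichletOp, dif_pos hex]
  exact hex.choose_spec.unique h

/-- Any `z` with `Γ z = u` is corrected by the `w ∈ ker Γ` for which `(lam - Am) w = (lam - Am) z`;
then `z - w` is the required element of `ker (lam - Am)`. Uniqueness makes the assignment linear and
its graph closed. -/
theorem IsBdryResolvent.exists_isDirichlet [CompleteSpace U] [CompleteSpace Z] {S : X →L[ℂ] Z}
    (hS : IsBdryResolvent ι Am Γ lam S) (hAm : Continuous Am) (hΓ : Function.Surjective Γ) :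
    ∃ D, IsDirichlet ι Am Γ lam D := by
  have huniq : ∀ z, Am z = lam • ι z → Γ z = 0 → z = 0 := fun z h1 h2 => by
    rw [← hS.1 z h2, h1, sub_self, map_zero]
  have huniq' : ∀ z z', Am z = lam • ι z → Am z' = lam • ι z' → Γ z = Γ z' → z = z' :=
    fun z z' h h' hz => sub_eq_zero.1 (huniq _ (by simp [h, h', smul_sub]) (by simp [hz]))
  have hex : ∀ u, ∃ z, Am z = lam • ι z ∧ Γ z = u := fun u => by
    obtain ⟨z, rfl⟩ := hΓ u
    obtain ⟨h1, h2⟩ := hS.2 (lam • ι z - Am z)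
    generalize S (lam • ι z - Am z) = w at h1 h2
    refine ⟨z - w, ?_, by rw [map_sub, h1, sub_zero]⟩
    rw [map_sub, map_sub, smul_sub, eq_comm, ← sub_eq_zero, sub_sub_sub_comm, h2, sub_self]
  choose d hd hd' using hex
  let l : U →ₗ[ℂ] Z :=
    { toFun := d
      map_add' := fun x y => huniq' _ _ (hd _) (by simp [hd]) (by simp [hd'])
      map_smul' := fun c x => huniq' _ _ (hd _) (by simp [hd, smul_comm lam c]) (by simp [hd']) }
  have hl : Continuous l := by
    refine l.continuous_of_seq_closed_graph fun u x y hu hy => huniq' _ _ ?_ (hd x) ?_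
    · refine tendsto_nhds_unique ((hAm.tendsto y).comp hy) ?_
      simpa only [Function.comp_def, LinearMap.coe_mk, AddHom.coe_mk, l, hd] using
        ((ι.continuous.tendsto y).comp hy).const_smul lam
    · refine (tendsto_nhds_unique ((Γ.continuous.tendsto y).comp hy) ?_).trans (hd' x).symm
      simpa only [Function.comp_def, LinearMap.coe_mk, AddHom.coe_mk, l, hd'] using hu
  exact ⟨⟨l, hl⟩, fun u => ⟨hd u, hd' u⟩, fun z hz => huniq' _ _ (hd _) hz (hd' _)⟩

theorem inverse_apply_eq_iff {E : Type*} [NormedAddCommGroup E] [NormedSpace ℂ E]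
    {T : E →L[ℂ] E} (hT : IsUnit T) {x y : E} : Ring.inverse T x = y ↔ x = T y := by
  constructor
  · rintro rfl
    exact (DFunLike.congr_fun (Ring.mul_inverse_cancel T hT) x).symm
  · rintro rfl
    exact DFunLike.congr_fun (Ring.inverse_mul_cancel T hT) y

section Perturbation

variable {D : U →L[ℂ] Z}

/-- The condition `G z = M z` is read as inhomogeneous data for `G`: `z` solves the perturbed
problem exactly if `z = D (M z) + S x`, that is, `(1 - D M) z = S x`. -/
theorem IsBdryResolvent.perturb {S : X →L[ℂ] Z} (hS : IsBdryResolvent ι Am G lam S)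
    (hD : IsDirichlet ι Am G lam D) (hu : IsUnit (1 - D ∘L M)) :
    IsBdryResolvent ι Am (G - M) lam (Ring.inverse (1 - D ∘L M) ∘L S) := by
  have hDl : ∀ u, lam • ι (D u) - Am (D u) = 0 := fun u => by rw [(hD.1 u).1, sub_self]
  refine ⟨fun z hz => ?_, fun x => ?_⟩
  · rw [ContinuousLinearMap.comp_apply, inverse_apply_eq_iff hu]
    have h1 : G z = M z := sub_eq_zero.1 hz
    have h2 := hS.1 (z - D (M z)) (by rw [map_sub, (hD.1 _).2, h1, sub_self])
    have h3 : lam • ι (z - D (M z)) - Am (z - D (M z)) = lam • ι z - Am z := by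
      rw [map_sub, map_sub, smul_sub, sub_sub_sub_comm, hDl, sub_zero]
    rw [← h3, h2]
    rfl
  · obtain ⟨z, hz⟩ : ∃ z, Ring.inverse (1 - D ∘L M) (S x) = z := ⟨_, rfl⟩
    rw [ContinuousLinearMap.comp_apply, hz]
    rw [inverse_apply_eq_iff hu] at hz
    have hz' : z = D (M z) + S x := by rw [hz]; simp
    obtain ⟨h1, h2⟩ := hS.2 x
    constructor
    · have : G z = M z := by
        conv_lhs => rw [hz']
        rw [map_add, (hD.1 _).2, h1, add_zero]
      exact sub_eq_zero.2 this
    · conv_lhs => rw [hz']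
      rw [map_add, map_add, smul_add, add_sub_add_comm, hDl, h2, zero_add]

/-- For `z ∈ ker (lam - Am)`, `(G - M) z = u` means `G z = u + M z`, hence `z = D (u + M z)`, that
is, `(1 - D M) z = D u`. -/
theorem IsDirichlet.perturb (hD : IsDirichlet ι Am G lam D) (hu : IsUnit (1 - D ∘L M)) :
    IsDirichlet ι Am (G - M) lam (Ring.inverse (1 - D ∘L M) ∘L D) := by
  refine ⟨fun u => ?_, fun z hz => ?_⟩
  · obtain ⟨z, hz⟩ : ∃ z, Ring.inverse (1 - D ∘L M) (D u) = z := ⟨_, rfl⟩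
    rw [ContinuousLinearMap.comp_apply, hz]
    rw [inverse_apply_eq_iff hu] at hz
    have hz' : z = D (M z + u) := by rw [map_add, hz]; simp
    refine ⟨?_, ?_⟩
    · rw [hz', (hD.1 _).1]
    · have : G z = M z + u := by
        conv_lhs => rw [hz']
        rw [(hD.1 _).2]
      rw [_root_.sub_apply, this, add_sub_cancel_left]
  · rw [ContinuousLinearMap.comp_apply, inverse_apply_eq_iff hu, _root_.sub_apply,
      map_sub, hD.2 z hz]
    rfl

end Perturbation

/-- The unique solvability of the boundary value problem for `lam - Am`. -/
theorem IsBdryResolvent.eq_add_iff {S : X →L[ℂ] Z} {D : U →L[ℂ] Z}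
    (hS : IsBdryResolvent ι Am Γ lam S) (hD : IsDirichlet ι Am Γ lam D) {z : Z} {x : X} {u : U} :
    z = S x + D u ↔ lam • ι z - Am z = x ∧ Γ z = u := by
  have hDl : ∀ u, lam • ι (D u) - Am (D u) = 0 := fun u => by rw [(hD.1 u).1, sub_self]
  constructor
  · rintro rfl
    rw [map_add, map_add, map_add, smul_add, add_sub_add_comm, hDl, (hS.2 x).1, (hS.2 x).2,
      (hD.1 u).2, add_zero, zero_add]
    exact ⟨rfl, rfl⟩
  · rintro ⟨rfl, rfl⟩
    have h := hS.1 (z - D (Γ z)) (by rw [map_sub, (hD.1 _).2, sub_self])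
    have h' : lam • ι (z - D (Γ z)) - Am (z - D (Γ z)) = lam • ι z - Am z := by
      rw [map_sub, map_sub, smul_sub, sub_sub_sub_comm, hDl, sub_zero]
    rw [← h', h, sub_add_cancel]

end Boundary

/-! ### The history space `W` and the equation `lam φ - φ' = ψ` on `[-1, 0]`. -/

section Extension

variable {X : Type*} [NormedAddCommGroup X]

/-- The constant extension of a function on `[-1, 0]` to the real line. -/
noncomputable def histExtend (f : C(HistI, X)) (s : ℝ) : X :=
  f (projIcc (-1) 0 (by norm_num) s)

theorem continuous_histExtend (f : C(HistI, X)) : Continuous (histExtend f) :=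
  f.continuous.comp continuous_projIcc

theorem histExtend_coe (f : C(HistI, X)) (θ : HistI) : histExtend f θ = f θ := by
  rw [histExtend, projIcc_val]

end Extension

section History

variable {X : Type*} [NormedAddCommGroup X] [NormedSpace ℂ X] {p : ℝ≥0∞} [Fact (1 ≤ p)]

theorem ae_restrict_uIoc {q : ℝ → Prop} (θ : HistI)
    (h : ∀ᵐ s ∂(volume.restrict (Icc (-1 : ℝ) 0)), q s) :
    ∀ᵐ s ∂(volume.restrict (uIoc 0 (θ : ℝ))), q s := by
  rw [uIoc_of_ge θ.2.2]
  exact ae_restrict_of_ae_restrict_of_subset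
    (Ioc_subset_Icc_self.trans (Icc_subset_Icc_left θ.2.1)) h

/-- The interval has length one, so the `L^1` norm is at most the `L^p` norm with constant `1`. -/
theorem norm_primitive_le (v : HistLp p X) (θ : HistI) :
    ‖∫ s in (0 : ℝ)..θ, v s‖ ≤ ‖v‖ := by
  have : IsProbabilityMeasure (volume.restrict (Icc (-1 : ℝ) 0)) := ⟨by simp⟩
  have hint : IntegrableOn (fun s => v s) (Icc (-1 : ℝ) 0) volume :=
    (Lp.memLp v).integrable Fact.out
  calc ‖∫ s in (0 : ℝ)..θ, v s‖ ≤ ∫ s in uIoc 0 (θ : ℝ), ‖v s‖ :=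
        intervalIntegral.norm_integral_le_integral_norm_uIoc
    _ ≤ ∫ s in Icc (-1 : ℝ) 0, ‖v s‖ := by
        refine setIntegral_mono_set hint.norm (Eventually.of_forall fun _ => norm_nonneg _) ?_
        rw [uIoc_of_ge θ.2.2]
        exact (Ioc_subset_Icc_self.trans (Icc_subset_Icc_left θ.2.1)).eventuallyLE
    _ = (eLpNorm v 1 (volume.restrict (Icc (-1 : ℝ) 0))).toReal := by
        rw [integral_norm_eq_lintegral_enorm hint.aestronglyMeasurable,
          eLpNorm_one_eq_lintegral_enorm]
    _ ≤ ‖v‖ := by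
        rw [Lp.norm_def]
        exact ENNReal.toReal_mono (Lp.eLpNorm_ne_top v)
          (eLpNorm_le_eLpNorm_of_exponent_le Fact.out (Lp.aestronglyMeasurable v))

theorem integral_add_histLp (v w : HistLp p X) (θ : HistI) :
    ∫ s in (0 : ℝ)..θ, (v + w) s = (∫ s in (0 : ℝ)..θ, v s) + ∫ s in (0 : ℝ)..θ, w s := by
  rw [← intervalIntegral.integral_add (v.intervalIntegrable θ) (w.intervalIntegrable θ)]
  exact intervalIntegral.integral_congr_ae_restrict (ae_restrict_uIoc θ (Lp.coeFn_add _ _))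

theorem integral_smul_histLp {X : Type*} [NormedAddCommGroup X] [NormedSpace ℂ X]
    {p : ℝ≥0∞} [Fact (1 ≤ p)] (c : ℂ) (v : HistLp p X) (θ : HistI) :
    ∫ s in (0 : ℝ)..θ, (c • v) s = c • ∫ s in (0 : ℝ)..θ, v s := by
  rw [← intervalIntegral.integral_smul]
  exact intervalIntegral.integral_congr_ae_restrict (ae_restrict_uIoc θ (Lp.coeFn_smul _ _))

/-- The functional `v ↦ ∫_0^θ v(s) ds` on `Y`. -/
noncomputable def primitiveAt (p : ℝ≥0∞) [Fact (1 ≤ p)] (X : Type*) [NormedAddCommGroup X]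
    [NormedSpace ℂ X] (θ : HistI) : HistLp p X →L[ℂ] X :=
  LinearMap.mkContinuous
    { toFun := fun v => ∫ s in (0 : ℝ)..θ, v s
      map_add' := fun v w => integral_add_histLp v w θ
      map_smul' := fun c v => integral_smul_histLp c v θ } 1
    fun v => by simpa using norm_primitive_le v θ

theorem primitiveAt_apply (θ : HistI) (v : HistLp p X) :
    primitiveAt p X θ v = ∫ s in (0 : ℝ)..θ, v s := rfl

theorem mem_W1p_iff {w : C(HistI, X) × HistLp p X} :
    w ∈ W1p p X ↔ ∀ θ, w.1 θ = w.1 zeroPt + primitiveAt p X θ w.2 := Iff.rfl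

/-- `W` is cut out by equations between continuous maps. Completeness is needed for the closed graph
theorem and for deducing invertibility of `1 - Δ` from bijectivity. -/
instance [CompleteSpace X] : CompleteSpace (W1p p X) := by
  have h : IsClosed (W1p p X : Set (C(HistI, X) × HistLp p X)) := by
    have : (W1p p X : Set (C(HistI, X) × HistLp p X)) =
        ⋂ θ, {w | w.1 θ = w.1 zeroPt + primitiveAt p X θ w.2} := by
      ext w; simp [mem_W1p_iff]
    rw [this]
    refine isClosed_iInter fun θ => isClosed_eq ?_ ?_
    · exact (continuous_eval_const θ).comp continuous_fst
    · exact ((continuous_eval_const zeroPt).comp continuous_fst).add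
        ((primitiveAt p X θ).continuous.comp continuous_snd)
  exact h.completeSpace_coe

theorem continuous_toHistLp : Continuous (toHistLp p : C(HistI, X) → HistLp p X) :=
  AddMonoidHomClass.continuous_of_bound (toHistLp p) 1
    fun f => by simpa using norm_toHistLp_le p f

theorem W1p.continuous_toLp : Continuous (W1p.toLp : W1p p X → HistLp p X) :=
  continuous_toHistLp.comp (continuous_fst.comp continuous_subtype_val)

theorem W1p.continuous_deriv : Continuous (W1p.deriv : W1p p X → HistLp p X) :=
  continuous_snd.comp continuous_subtype_val

theorem W1p.continuous_eval (θ : HistI) : Continuous (W1p.eval θ : W1p p X → X) :=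
  (continuous_eval_const θ).comp (continuous_fst.comp continuous_subtype_val)

theorem coeFn_toHistLp (f : C(HistI, X)) :
    toHistLp p f =ᵐ[volume.restrict (Icc (-1 : ℝ) 0)] histExtend f :=
  (memLp_extend p f).coeFn_toLp

theorem primitiveAt_toHistLp (f : C(HistI, X)) (θ : HistI) :
    primitiveAt p X θ (toHistLp p f) = ∫ s in (0 : ℝ)..θ, histExtend f s :=
  intervalIntegral.integral_congr_ae_restrict (ae_restrict_uIoc θ (coeFn_toHistLp f))

theorem toHistLp_injective : Function.Injective (toHistLp p : C(HistI, X) → HistLp p X) := by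
  intro f g h
  have h1 : histExtend f =ᵐ[volume.restrict (Icc (-1 : ℝ) 0)] histExtend g :=
    (coeFn_toHistLp (p := p) f).symm.trans ((Filter.EventuallyEq.of_eq (by rw [h])).trans
      (coeFn_toHistLp g))
  have h2 := Measure.eqOn_Icc_of_ae_eq volume (by norm_num : (-1 : ℝ) ≠ 0) h1
    (continuous_histExtend f).continuousOn (continuous_histExtend g).continuousOn
  ext θ
  rw [← histExtend_coe f, ← histExtend_coe g]
  exact h2 θ.2

/-- By Lebesgue differentiation the primitive has derivative `v` almost everywhere, while it
vanishes identically on the interval. -/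
theorem eq_zero_of_primitiveAt [CompleteSpace X] {v : HistLp p X}
    (h : ∀ θ, primitiveAt p X θ v = 0) : v = 0 := by
  have h1 := (v.intervalIntegrable ⟨-1, by norm_num⟩).symm.ae_hasDerivAt_integral
  rw [uIcc_of_le (by norm_num)] at h1
  -- The endpoints are discarded because the primitive is known to vanish only inside the interval,
  -- and a two-sided neighbourhood is needed.
  have h0 : ∀ᵐ x : ℝ ∂volume, x ≠ -1 := by simp [ae_iff]
  have h0' : ∀ᵐ x : ℝ ∂volume, x ≠ 0 := by simp [ae_iff]
  refine Lp.ext ?_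
  refine EventuallyEq.trans ?_ (Lp.coeFn_zero X p _).symm
  filter_upwards [ae_restrict_of_ae h1, ae_restrict_of_ae h0, ae_restrict_of_ae h0',
    ae_restrict_mem measurableSet_Icc] with x hx hx1 hx2 hx3
  have hd := hx hx3 0 (by norm_num)
  have hd' : HasDerivAt (fun x => ∫ t in (0 : ℝ)..x, v t) 0 x := by
    refine (hasDerivAt_const x (0 : X)).congr_of_eventuallyEq ?_
    filter_upwards [Ioo_mem_nhds (lt_of_le_of_ne hx3.1 hx1.symm) (lt_of_le_of_ne hx3.2 hx2)]
      with y hy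
    exact h ⟨y, hy.1.le, hy.2.le⟩
  exact hd.unique hd'

theorem W1p.fst_injective [CompleteSpace X] {φ ψ : W1p p X} (h : φ.1.1 = ψ.1.1) : φ = ψ := by
  refine Subtype.ext (Prod.ext h (sub_eq_zero.1 (eq_zero_of_primitiveAt fun θ => ?_)))
  have h1 := mem_W1p_iff.1 φ.2 θ
  rw [h, mem_W1p_iff.1 ψ.2 θ] at h1
  rw [map_sub, sub_eq_zero]
  exact (add_left_cancel h1).symm

theorem W1p.toLp_injective [CompleteSpace X] :
    Function.Injective (W1p.toLp : W1p p X → HistLp p X) :=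
  fun _ _ h => W1p.fst_injective (toHistLp_injective h)

theorem hasDerivAt_exp_mul (lam : ℂ) (t : ℝ) :
    HasDerivAt (fun s : ℝ => Complex.exp (lam * (s : ℂ)))
      (lam * Complex.exp (lam * (t : ℂ))) t := by
  have h1 : HasDerivAt (fun s : ℝ => lam * (s : ℂ)) lam t := by
    simpa using (Complex.ofRealCLM.hasDerivAt (x := t)).const_mul lam
  simpa [mul_comm] using h1.cexp

/-- A continuous function on `[-1, 0]` that satisfies `f(θ) = lam ∫_0^θ f(s) ds` vanishes. -/
theorem eq_zero_of_eq_smul_integral [CompleteSpace X] {lam : ℂ} {f : C(HistI, X)}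
    (h : ∀ θ : HistI, f θ = lam • ∫ s in (0 : ℝ)..θ, histExtend f s) : f = 0 := by
  set F : ℝ → X := fun t => ∫ s in (0 : ℝ)..t, histExtend f s with hF
  have hF' : ∀ t, HasDerivAt F (histExtend f t) t := fun t =>
    intervalIntegral.integral_hasDerivAt_right
      ((continuous_histExtend f).intervalIntegrable _ _)
      ((continuous_histExtend f).stronglyMeasurableAtFilter _ _)
      (continuous_histExtend f).continuousAt
  -- Integrating factor: `F' = lam F` makes `e^{-lam t} F(t)` constant, and `F 0 = 0`.
  have hd : ∀ t ∈ Icc (-1 : ℝ) 0,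
      HasDerivWithinAt (fun t : ℝ => Complex.exp (-lam * (t : ℂ)) • F t) 0 (Icc (-1) 0) t := by
    intro t ht
    have h1 := ((hasDerivAt_exp_mul (-lam) t).smul (hF' t)).hasDerivWithinAt (s := Icc (-1) 0)
    have h2 : histExtend f t = lam • F t := by
      rw [← h ⟨t, ht⟩, ← histExtend_coe]
    rw [h2] at h1
    exact h1.congr_deriv (by module)
  ext θ
  have h3 := (convex_Icc (-1 : ℝ) 0).norm_image_sub_le_of_norm_hasDerivWithin_le (C := 0) hd
    (by simp) (by norm_num : (0 : ℝ) ∈ Icc (-1 : ℝ) 0) θ.2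
  have h4 : F 0 = 0 := by simp [hF]
  rw [h4, smul_zero, sub_zero, zero_mul, norm_le_zero_iff,
    smul_eq_zero_iff_right (Complex.exp_ne_zero _)] at h3
  rw [h θ]
  change lam • F θ = 0
  rw [h3, smul_zero]

theorem W1p.eq_zero_of_eval_zero [CompleteSpace X] {lam : ℂ} {φ : W1p p X}
    (h0 : W1p.eval zeroPt φ = 0) (h : lam • W1p.toLp φ - W1p.deriv φ = 0) : φ = 0 := by
  refine W1p.fst_injective (eq_zero_of_eq_smul_integral (lam := lam) fun θ => ?_)
  have h1 := mem_W1p_iff.1 φ.2 θ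
  have h2 : φ.1.1 zeroPt = 0 := h0
  have h3 : φ.1.2 = lam • toHistLp p φ.1.1 := (sub_eq_zero.1 h).symm
  rw [h1, h2, h3, map_smul, primitiveAt_toHistLp, zero_add]

/-- As `ψ` is only in `L^p`, its continuous primitive `Ψ` is split off: with `φ = H - Ψ`, the
equation `φ' = lam φ - ψ` becomes `H' = lam H - lam Ψ`, which has continuous data and is solved
classically by variation of constants. -/
theorem W1p.exists_eval_zero [CompleteSpace X] (lam : ℂ) (ψ : HistLp p X) :
    ∃ φ : W1p p X, W1p.eval zeroPt φ = 0 ∧ lam • W1p.toLp φ - W1p.deriv φ = ψ := by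
  let Ψ : C(HistI, X) :=
    { toFun := fun θ => primitiveAt p X θ ψ
      continuous_toFun := by
        have h1 := intervalIntegral.continuousOn_primitive_interval' (a := 0)
          (ψ.intervalIntegrable ⟨-1, by norm_num⟩).symm (by simp)
        rw [uIcc_of_le (by norm_num)] at h1
        exact h1.domRestrict }
  set F : ℝ → X := fun t =>
    ∫ s in (0 : ℝ)..t, Complex.exp (-lam * (s : ℂ)) • lam • histExtend Ψ s with hF
  have hc : Continuous fun s : ℝ => Complex.exp (-lam * (s : ℂ)) • lam • histExtend Ψ s := by
    have := continuous_histExtend Ψ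
    fun_prop
  set H : ℝ → X := fun t => -(Complex.exp (lam * (t : ℂ)) • F t) with hH
  have hH' : ∀ t, HasDerivAt H (lam • H t - lam • histExtend Ψ t) t := by
    intro t
    have h1 : HasDerivAt F (Complex.exp (-lam * (t : ℂ)) • lam • histExtend Ψ t) t :=
      intervalIntegral.integral_hasDerivAt_right (hc.intervalIntegrable _ _)
        (hc.stronglyMeasurableAtFilter _ _) hc.continuousAt
    refine ((hasDerivAt_exp_mul lam t).smul h1).neg.congr_deriv ?_
    rw [smul_smul (Complex.exp _), ← Complex.exp_add]
    simp only [hH, neg_mul, add_neg_cancel, Complex.exp_zero]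
    module
  have hHc : Continuous H := continuous_iff_continuousAt.2 fun t => (hH' t).continuousAt
  have hH0 : H 0 = 0 := by simp [hH, hF]
  let g : C(HistI, X) := ⟨fun θ => H θ, hHc.comp continuous_subtype_val⟩ - Ψ
  have hg0 : g zeroPt = 0 := by
    change H 0 - primitiveAt p X zeroPt ψ = 0
    rw [hH0, primitiveAt_apply]
    simp [zeroPt]
  have hmem : (g, lam • toHistLp p g - ψ) ∈ W1p p X := by
    rw [mem_W1p_iff]
    intro θ
    simp only [hg0, zero_add, map_sub, map_smul]
    rw [primitiveAt_toHistLp, ← intervalIntegral.integral_smul]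
    have h1 : ∫ s in (0 : ℝ)..θ, lam • histExtend g s = H θ := by
      have h2 : ∫ s in (0 : ℝ)..θ, (lam • H s - lam • histExtend Ψ s) = H θ - H 0 :=
        intervalIntegral.integral_eq_sub_of_hasDerivAt (fun t _ => hH' t)
          (by
            have := continuous_histExtend Ψ
            exact Continuous.intervalIntegrable (by fun_prop) _ _)
      rw [hH0, sub_zero] at h2
      rw [← h2]
      refine intervalIntegral.integral_congr fun s hs => ?_
      rw [uIcc_of_ge θ.2.2] at hs
      have hs' : s ∈ Icc (-1 : ℝ) 0 := ⟨θ.2.1.trans hs.1, hs.2⟩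
      have h3 := histExtend_coe g ⟨s, hs'⟩
      have h4 := histExtend_coe Ψ ⟨s, hs'⟩
      simp only at h3 h4
      simp only [h3, h4, ← smul_sub]
      rfl
    rw [h1]
    rfl
  exact ⟨⟨_, hmem⟩, hg0, sub_sub_cancel _ _⟩

/-- `RQ` is the inverse of `φ ↦ lam φ - φ'` on `{φ ∈ W : φ(0) = 0}`. -/
theorem exists_histResolvent [CompleteSpace X] (p : ℝ≥0∞) [Fact (1 ≤ p)] (lam : ℂ) :
    ∃ RQ : HistLp p X →L[ℂ] W1p p X, ∀ ψ, W1p.eval zeroPt (RQ ψ) = 0 ∧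
      lam • W1p.toLp (RQ ψ) - W1p.deriv (RQ ψ) = ψ := by
  choose r hr0 hr using W1p.exists_eval_zero (X := X) (p := p) lam
  -- Uniqueness for given `φ(0)` and `lam φ - φ'` gives both linearity of the chosen solution and
  -- closedness of its graph.
  have huniq : ∀ φ ψ : W1p p X, W1p.eval zeroPt φ = W1p.eval zeroPt ψ →
      lam • W1p.toLp φ - W1p.deriv φ = lam • W1p.toLp ψ - W1p.deriv ψ → φ = ψ := by
    intro φ ψ h1 h2
    refine sub_eq_zero.1 (W1p.eq_zero_of_eval_zero (lam := lam) (by simp [h1]) ?_)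
    rw [map_sub, map_sub, smul_sub, sub_sub_sub_comm, h2, sub_self]
  let l : HistLp p X →ₗ[ℂ] W1p p X :=
    { toFun := r
      map_add' := fun x y => huniq _ _ (by simp [hr0]) (by
        rw [hr, map_add, map_add, smul_add, add_sub_add_comm, hr, hr])
      map_smul' := fun c x => huniq _ _ (by simp [hr0]) (by
        rw [hr, map_smul, map_smul, smul_comm, RingHom.id_apply, ← smul_sub, hr]) }
  have hl : Continuous l := by
    refine LinearMap.continuous_of_seq_closed_graph (𝕜 := ℂ) (E := HistLp p X) (F := W1p p X)
      (g := l) fun u x y hu hy => huniq _ _ ?_ ?_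
    · refine (tendsto_nhds_unique (((W1p.continuous_eval zeroPt).tendsto y).comp hy) ?_).trans
        (hr0 x).symm
      exact tendsto_const_nhds.congr fun n => (hr0 (u n)).symm
    · have hc : Continuous fun φ : W1p p X => lam • W1p.toLp φ - W1p.deriv φ :=
        (W1p.continuous_toLp.const_smul lam).sub W1p.continuous_deriv
      refine (tendsto_nhds_unique ((hc.tendsto y).comp hy) ?_).trans (hr x).symm
      exact hu.congr fun n => (hr (u n)).symm
  exact ⟨⟨l, hl⟩, fun ψ => ⟨hr0 ψ, hr ψ⟩⟩

theorem W1p.eval_expOp [CompleteSpace X] (lam : ℂ) (x : X) (θ : HistI) :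
    W1p.eval θ (expOp p lam x) = Complex.exp (lam * ((θ : ℝ) : ℂ)) • x := rfl

theorem W1p.eval_zeroPt_expOp [CompleteSpace X] (lam : ℂ) (x : X) :
    W1p.eval zeroPt (expOp p lam x) = x := by
  simp [W1p.eval_expOp, zeroPt]

theorem W1p.deriv_expOp [CompleteSpace X] (lam : ℂ) (x : X) :
    lam • W1p.toLp (expOp p lam x) - W1p.deriv (expOp p lam x) = 0 := sub_self _

/-- Every `φ ∈ W` is determined by `φ(0)` and `lam φ - φ'`. -/
theorem W1p.eq_expOp_add_iff [CompleteSpace X] {lam : ℂ} {RQ : HistLp p X →L[ℂ] W1p p X}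
    (hRQ : ∀ ψ, W1p.eval zeroPt (RQ ψ) = 0 ∧
      lam • W1p.toLp (RQ ψ) - W1p.deriv (RQ ψ) = ψ)
    {φ : W1p p X} {x : X} {ψ : HistLp p X} :
    φ = expOp p lam x + RQ ψ ↔
      W1p.eval zeroPt φ = x ∧ lam • W1p.toLp φ - W1p.deriv φ = ψ := by
  have key : W1p.eval zeroPt (expOp p lam x + RQ ψ) = x ∧
      lam • W1p.toLp (expOp p lam x + RQ ψ) - W1p.deriv (expOp p lam x + RQ ψ) = ψ := by
    rw [map_add, map_add, map_add, smul_add, add_sub_add_comm, W1p.deriv_expOp,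
      W1p.eval_zeroPt_expOp, (hRQ ψ).1, (hRQ ψ).2]
    exact ⟨add_zero _, zero_add _⟩
  constructor
  · rintro rfl
    exact key
  · rintro ⟨h1, h2⟩
    refine sub_eq_zero.1 (W1p.eq_zero_of_eval_zero (lam := lam) ?_ ?_)
    · rw [map_sub, key.1, h1, sub_self]
    · rw [map_sub, map_sub, smul_sub, sub_sub_sub_comm, key.2, h2, sub_self]

theorem isResolventAt_shiftGen [CompleteSpace X] {lam : ℂ} {RQ : HistLp p X →L[ℂ] W1p p X}
    (hRQ : ∀ ψ, W1p.eval zeroPt (RQ ψ) = 0 ∧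
      lam • W1p.toLp (RQ ψ) - W1p.deriv (RQ ψ) = ψ) :
    IsResolventAt (shiftGen p X) lam (⟨W1p.toLp, W1p.continuous_toLp⟩ ∘L RQ) := by
  rw [shiftGen, isResolventAt_opOn_iff
    (fun a b h => Subtype.ext (W1p.toLp_injective h))]
  refine ⟨fun φ => ?_, fun ψ => ⟨⟨RQ ψ, (hRQ ψ).1⟩, rfl, (hRQ ψ).2⟩⟩
  have h := (W1p.eq_expOp_add_iff hRQ (φ := φ.1)).2 ⟨φ.2, rfl⟩
  rw [map_zero, zero_add] at h
  exact congrArg W1p.toLp h.symm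

end History

/-! ### Smallness of delay operators on steep exponentials. -/

section Stieltjes

variable {X U : Type*} [NormedAddCommGroup X] [NormedSpace ℂ X]
  [NormedAddCommGroup U] [NormedSpace ℂ U] [CompleteSpace U]

/-- The vector measure of a point is the jump of `f` there, and a singleton has no other subsets
than itself and `∅`. -/
theorem variation_singleton_eq_zero {E : Type*} [NormedAddCommGroup E] [CompleteSpace E]
    {f : HistI → E} (hf : BoundedVariationOn f univ) {a : HistI} (ha : ContinuousAt f a) :
    hf.vectorMeasure.variation {a} = 0 := by
  rw [VectorMeasure.variation_apply_eq_zero (measurableSet_singleton a)]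
  intro t ht _
  rcases subset_singleton_iff_eq.1 ht with rfl | rfl
  · simp
  · rw [hf.vectorMeasure_singleton, ha.continuousWithinAt.rightLim_eq,
      ha.continuousWithinAt.leftLim_eq, sub_self]

theorem norm_expFun_ofReal (r : ℝ) (x : X) (θ : HistI) :
    ‖expFun (r : ℂ) x θ‖ = Real.exp (r * θ) * ‖x‖ := by
  change ‖Complex.exp ((r : ℂ) * ((θ : ℝ) : ℂ)) • x‖ = _
  rw [norm_smul, ← Complex.ofReal_mul, ← Complex.ofReal_exp, Complex.norm_real,
    Real.norm_of_nonneg (Real.exp_pos _).le]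

set_option maxSynthPendingDepth 4 in
theorem norm_stieltjes_expFun_le {ν : HistI → X →L[ℂ] U} (hν : BoundedVariationOn ν univ)
    (r : ℝ) (x : X) :
    ‖stieltjes ν hν (expFun (r : ℂ) x)‖ ≤
      ‖pairing X U‖ * (∫ θ : HistI, Real.exp (r * θ) ∂hν.vectorMeasure.variation) * ‖x‖ := by
  change ‖hν.vectorMeasure.integral (fun θ => expFun (r : ℂ) x θ) (pairing X U)‖ ≤ _
  refine VectorMeasure.norm_integral_le_integral_norm.trans_eq ?_
  simp only [norm_expFun_ofReal]
  rw [integral_mul_const, mul_assoc]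

/-- Dominated convergence with bound `1`: `e^{nθ} → 0` for `θ < 0`, and the exceptional point `0`
carries no mass. -/
theorem tendsto_integral_exp {m : Measure HistI} [IsFiniteMeasure m] (hm : m {zeroPt} = 0) :
    Tendsto (fun n : ℕ => ∫ θ : HistI, Real.exp ((n : ℝ) * θ) ∂m) atTop (𝓝 0) := by
  have h := tendsto_integral_of_dominated_convergence (μ := m)
    (F := fun (n : ℕ) (θ : HistI) => Real.exp ((n : ℝ) * θ)) (f := fun _ => (0 : ℝ))
    (fun _ => (1 : ℝ)) (fun n => (by fun_prop : Continuous fun θ : HistI =>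
      Real.exp ((n : ℝ) * θ)).aestronglyMeasurable) (integrable_const 1) ?_ ?_
  · simpa using h
  · refine fun n => Eventually.of_forall fun θ => ?_
    rw [Real.norm_of_nonneg (Real.exp_pos _).le, Real.exp_le_one_iff]
    exact mul_nonpos_of_nonneg_of_nonpos n.cast_nonneg θ.2.2
  · have h0 : ∀ᵐ θ ∂m, θ ≠ zeroPt := by simpa [ae_iff] using hm
    filter_upwards [h0] with θ hθ
    have hθ' : (θ : ℝ) < 0 := lt_of_le_of_ne θ.2.2 fun h => hθ (Subtype.ext h)
    exact Real.tendsto_exp_atBot.comp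
      (tendsto_natCast_atTop_atTop.atTop_mul_const_of_neg hθ')

set_option maxSynthPendingDepth 4 in
/-- The delay operator is small on steep exponentials if `ν` has no jump at `0`. -/
theorem tendsto_norm_delayOp_comp_expOp [CompleteSpace X] (p : ℝ≥0∞) [Fact (1 ≤ p)]
    {ν : HistI → X →L[ℂ] U} (hν : BoundedVariationOn ν univ) (h0 : ContinuousAt ν zeroPt) :
    Tendsto (fun n : ℕ => ‖delayOp p ν hν ∘L expOp p ((n : ℝ) : ℂ)‖) atTop (𝓝 0) := by
  have := isFiniteMeasure_variation hν
  have h := (tendsto_integral_exp (variation_singleton_eq_zero hν h0)).const_mul ‖pairing X U‖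
  rw [mul_zero] at h
  refine squeeze_zero (fun _ => norm_nonneg _) (fun n => ?_) h
  refine ContinuousLinearMap.opNorm_le_bound _ ?_ fun x => norm_stieltjes_expFun_le hν n x
  exact mul_nonneg (norm_nonneg _) (integral_nonneg fun _ => (Real.exp_pos _).le)

end Stieltjes

/-! ### Reduction of the delay operator matrix to `1 - Δ`, in both directions. -/

section Delay

variable {X U Z : Type*} [NormedAddCommGroup X] [NormedSpace ℂ X] [CompleteSpace X]
  [NormedAddCommGroup U] [NormedSpace ℂ U] [NormedAddCommGroup Z] [NormedSpace ℂ Z]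
  {p : ℝ≥0∞} [Fact (1 ≤ p)] {ι : Z →L[ℂ] X} {Am : Z →ₗ[ℂ] X} {G M : Z →L[ℂ] U}
  {P : W1p p X →L[ℂ] X} {L : W1p p X →L[ℂ] U} {lam : ℂ}
  {S : X →L[ℂ] Z} {D : U →L[ℂ] Z} {RQ : HistLp p X →L[ℂ] W1p p X}

theorem isResolventAt_delayMatrix_iff (hι : Function.Injective ι)
    {R : (X × HistLp p X) →L[ℂ] (X × HistLp p X)} :
    IsResolventAt (delayMatrix ι Am G M P L) lam R ↔
      (∀ z φ, (G - M) z = L φ → ι z = W1p.eval zeroPt φ →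
        R (lam • ι z - (Am z + P φ), lam • W1p.toLp φ - W1p.deriv φ) = (ι z, W1p.toLp φ)) ∧
      ∀ x ψ, ∃ z φ, ((G - M) z = L φ ∧ ι z = W1p.eval zeroPt φ) ∧
        R (x, ψ) = (ι z, W1p.toLp φ) ∧
        lam • ι z - (Am z + P φ) = x ∧ lam • W1p.toLp φ - W1p.deriv φ = ψ := by
  rw [delayMatrix, isResolventAt_opOn_iff]
  · constructor
    · rintro ⟨h1, h2⟩
      refine ⟨fun z φ h h' => h1 ⟨(z, φ), h, h'⟩, fun x ψ => ?_⟩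
      obtain ⟨⟨⟨z, φ⟩, h⟩, h3, h4⟩ := h2 (x, ψ)
      exact ⟨z, φ, h, h3.symm, congrArg Prod.fst h4, congrArg Prod.snd h4⟩
    · rintro ⟨h1, h2⟩
      refine ⟨fun d => h1 d.1.1 d.1.2 d.2.1 d.2.2, fun y => ?_⟩
      obtain ⟨z, φ, h, h3, h4, h5⟩ := h2 y.1 y.2
      exact ⟨⟨(z, φ), h⟩, h3.symm, Prod.ext h4 h5⟩
  · intro a b h
    exact Subtype.ext (Prod.ext (hι (congrArg Prod.fst h))
      (W1p.toLp_injective (congrArg Prod.snd h)))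

/-- The resolvent equation of the delay operator matrix, reduced to an equation in `W`. -/
theorem delay_eq_iff (hS : IsBdryResolvent ι Am (G - M) lam S)
    (hD : IsDirichlet ι Am (G - M) lam D)
    (hRQ : ∀ ψ, W1p.eval zeroPt (RQ ψ) = 0 ∧
      lam • W1p.toLp (RQ ψ) - W1p.deriv (RQ ψ) = ψ)
    {z : Z} {φ : W1p p X} {x : X} {ψ : HistLp p X} :
    (((G - M) z = L φ ∧ ι z = W1p.eval zeroPt φ) ∧
        lam • ι z - (Am z + P φ) = x ∧ lam • W1p.toLp φ - W1p.deriv φ = ψ) ↔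
      z = S (x + P φ) + D (L φ) ∧
        φ - expOp p lam (ι (S (P φ) + D (L φ))) = expOp p lam (ι (S x)) + RQ ψ := by
  -- Once `z` is given by the first equation, the second one says `φ = e_lam (ι z) + RQ ψ`; the part
  -- of `ι z` depending on `φ` has been moved to the left.
  have h1 : z = S (x + P φ) + D (L φ) →
      (φ - expOp p lam (ι (S (P φ) + D (L φ))) = expOp p lam (ι (S x)) + RQ ψ ↔
        W1p.eval zeroPt φ = ι z ∧ lam • W1p.toLp φ - W1p.deriv φ = ψ) := by
    rintro rfl
    rw [← W1p.eq_expOp_add_iff hRQ, sub_eq_iff_eq_add]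
    have : expOp p lam (ι (S x)) + RQ ψ + expOp p lam (ι (S (P φ) + D (L φ))) =
        expOp p lam (ι (S (x + P φ) + D (L φ))) + RQ ψ := by
      simp only [map_add]
      abel
    rw [this]
  have h2 := hS.eq_add_iff hD (z := z) (x := x + P φ) (u := L φ)
  have h3 : lam • ι z - (Am z + P φ) = x ↔ lam • ι z - Am z = x + P φ := by
    rw [← sub_sub, sub_eq_iff_eq_add]
  rw [h3]
  constructor
  · rintro ⟨⟨h4, h5⟩, h6, h7⟩
    have h8 := h2.2 ⟨h6, h4⟩
    exact ⟨h8, (h1 h8).2 ⟨h5.symm, h7⟩⟩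
  · rintro ⟨h4, h5⟩
    obtain ⟨h6, h7⟩ := (h1 h4).1 h5
    obtain ⟨h8, h9⟩ := h2.1 h4
    exact ⟨⟨h9, h6.symm⟩, h8, h7⟩

/-- The candidate for the resolvent of the delay operator matrix, built from an inverse `T` of
`1 - Δ`. -/
noncomputable def delayResolvent (T : W1p p X →L[ℂ] W1p p X) (lam : ℂ) (RM : X →L[ℂ] X)
    (RQ : HistLp p X →L[ℂ] W1p p X) : (X × HistLp p X) →L[ℂ] (X × HistLp p X) :=
  ContinuousLinearMap.prod ⟨W1p.eval zeroPt, W1p.continuous_eval zeroPt⟩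
      ⟨W1p.toLp, W1p.continuous_toLp⟩ ∘L
    T ∘L (expOp p lam ∘L RM).coprod RQ

theorem delayResolvent_apply (T : W1p p X →L[ℂ] W1p p X) (lam : ℂ) (RM : X →L[ℂ] X)
    (RQ : HistLp p X →L[ℂ] W1p p X) (x : X) (ψ : HistLp p X) :
    delayResolvent T lam RM RQ (x, ψ) =
      (W1p.eval zeroPt (T (expOp p lam (RM x) + RQ ψ)),
        W1p.toLp (T (expOp p lam (RM x) + RQ ψ))) := rfl

variable {Δ : W1p p X →L[ℂ] W1p p X}

theorem isResolventAt_delayResolvent (hι : Function.Injective ι)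
    (hS : IsBdryResolvent ι Am (G - M) lam S) (hD : IsDirichlet ι Am (G - M) lam D)
    (hRQ : ∀ ψ, W1p.eval zeroPt (RQ ψ) = 0 ∧
      lam • W1p.toLp (RQ ψ) - W1p.deriv (RQ ψ) = ψ)
    (hΔ : ∀ φ, Δ φ = expOp p lam (ι (S (P φ) + D (L φ)))) (hu : IsUnit (1 - Δ)) :
    IsResolventAt (delayMatrix ι Am G M P L) lam
      (delayResolvent (Ring.inverse (1 - Δ)) lam (ι ∘L S) RQ) := by
  rw [isResolventAt_delayMatrix_iff hι]
  refine ⟨fun z φ h1 h2 => ?_, fun x ψ => ?_⟩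
  · have h := ((delay_eq_iff hS hD hRQ (P := P) (L := L)).1 ⟨⟨h1, h2⟩, rfl, rfl⟩).2
    rw [← hΔ] at h
    have hφ : Ring.inverse (1 - Δ) (φ - Δ φ) = φ :=
      (inverse_apply_eq_iff (E := W1p p X) hu).2 rfl
    rw [delayResolvent_apply, ContinuousLinearMap.comp_apply, ← h, hφ, h2]
  · obtain ⟨φ, hφ⟩ : ∃ φ, Ring.inverse (1 - Δ) (expOp p lam (ι (S x)) + RQ ψ) = φ := ⟨_, rfl⟩
    have h1 := (inverse_apply_eq_iff (E := W1p p X) hu).1 hφ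
    have h2 : φ - expOp p lam (ι (S (P φ) + D (L φ))) = expOp p lam (ι (S x)) + RQ ψ := by
      rw [h1, ← hΔ]
      rfl
    obtain ⟨h3, h4⟩ := (delay_eq_iff hS hD hRQ (P := P) (L := L)).2 ⟨rfl, h2⟩
    refine ⟨_, φ, h3, ?_, h4⟩
    rw [delayResolvent_apply, ContinuousLinearMap.comp_apply, hφ, h3.2]

/-- Bijectivity suffices by the open mapping theorem. Surjectivity cannot be read off from
`delay_eq_iff`, whose right-hand sides have a value at `0` in `D(A^M)`; smallness of `L` on steep
exponentials closes this gap. -/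
theorem isUnit_one_sub_of_isResolventAt [CompleteSpace U] (hι : Function.Injective ι)
    (hS : IsBdryResolvent ι Am (G - M) lam S) (hD : IsDirichlet ι Am (G - M) lam D)
    (hL : Tendsto (fun n : ℕ => ‖L ∘L expOp p ((n : ℝ) : ℂ)‖) atTop (𝓝 0))
    (hΔ : ∀ φ, Δ φ = expOp p lam (ι (S (P φ) + D (L φ))))
    {R : (X × HistLp p X) →L[ℂ] (X × HistLp p X)}
    (hR : IsResolventAt (delayMatrix ι Am G M P L) lam R) : IsUnit (1 - Δ) := by
  obtain ⟨RQ, hRQ⟩ := exists_histResolvent (X := X) p lam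
  rw [isResolventAt_delayMatrix_iff hι] at hR
  refine (ContinuousLinearMap.isUnit_iff_bijective (𝕜 := ℂ) (E := W1p p X)).2 ⟨?_, ?_⟩
  -- A fixed point of `Δ` yields an element of the kernel of `lam - 𝒜`, hence vanishes.
  · refine (injective_iff_map_eq_zero _).2 fun φ hφ => W1p.toLp_injective ?_
    have h1 : φ - expOp p lam (ι (S (P φ) + D (L φ))) =
        expOp p lam (ι (S 0)) + RQ (0 : HistLp p X) := by
      rw [← hΔ]
      simpa using hφ
    obtain ⟨h2, h3, h4⟩ := (delay_eq_iff hS hD hRQ (P := P) (L := L)).2 ⟨rfl, h1⟩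
    have h5 := hR.1 _ φ h2.1 h2.2
    rw [h3, h4, Prod.mk_zero_zero, map_zero] at h5
    rw [map_zero]
    exact (congrArg Prod.snd h5).symm
  · intro f
    -- This choice of `n` makes `1 - L e_n ι D` invertible, so that `v` can be chosen with `(G -
    -- M)(D v) - L h = L f` for `h = e_n ι D v`.
    obtain ⟨n, hn⟩ : ∃ n : ℕ, ‖(L ∘L expOp p ((n : ℝ) : ℂ)) ∘L ι ∘L D‖ < 1 := by
      have h := hL.mul_const ‖ι ∘L D‖
      rw [zero_mul] at h
      obtain ⟨n, hn⟩ := (h.eventually_lt_const one_pos).exists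
      exact ⟨n, (ContinuousLinearMap.opNorm_comp_le _ _).trans_lt hn⟩
    obtain ⟨v, hv⟩ := (ContinuousLinearMap.isUnit_iff_bijective.1
      (isUnit_one_sub_of_norm_lt_one hn)).2 (L f)
    set h : W1p p X := expOp p ((n : ℝ) : ℂ) (ι (D v)) with hh
    have hv' : v - L h = L f := hv
    have hh0 : W1p.eval zeroPt h = ι (D v) := W1p.eval_zeroPt_expOp _ _
    -- The data are what `f` and `h` leave over: `(D v + w, h + g)` then satisfies `(lam - Am)(D v +
    -- w) = P (f + h + g)`, and `lam η - η' = 0` for `η = h + g`.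
    obtain ⟨w, g, ⟨h1, h2⟩, -, h3, h4⟩ :=
      hR.2 (P f + P h) (-(lam • W1p.toLp h - W1p.deriv h))
    have e1 : D v + w = S (P (f + (h + g))) + D (L (f + (h + g))) := by
      rw [hS.eq_add_iff hD]
      constructor
      · have hd := (hD.1 v).1
        rw [← sub_sub, sub_eq_iff_eq_add] at h3
        rw [map_add, map_add, smul_add, add_sub_add_comm, hd, sub_self, zero_add, h3]
        simp only [map_add]
        abel
      · rw [map_add, (hD.1 v).2, h1, map_add, map_add, ← hv']
        abel
    have e2 : h + g = expOp p lam (ι (D v + w)) + RQ 0 := by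
      rw [W1p.eq_expOp_add_iff hRQ]
      constructor
      · rw [map_add, map_add, hh0, h2]
      · rw [map_add, map_add, smul_add, add_sub_add_comm, h4, add_neg_cancel]
    -- By `e1` and `e2`, `Δ (f + h + g) = e_lam ι (D v + w) = h + g`.
    refine ⟨f + (h + g), ?_⟩
    change f + (h + g) - Δ (f + (h + g)) = f
    rw [hΔ, ← e1]
    rw [map_zero, add_zero] at e2
    rw [← e2, add_sub_cancel_right]

end Delay

end BoundaryDelay

/-! ### The characteristic equation and the resolvent matrix. -/

theorem theorem4p1 {X U Z : Type*}
    [NormedAddCommGroup X] [NormedSpace ℂ X] [CompleteSpace X]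
    [NormedAddCommGroup U] [NormedSpace ℂ U] [CompleteSpace U]
    [NormedAddCommGroup Z] [NormedSpace ℂ Z] [CompleteSpace Z]
    (p : ℝ≥0∞) [Fact (1 ≤ p)] (hp : p ≠ ∞)
    (ι : Z →L[ℂ] X) (Am : Z →ₗ[ℂ] X) (G M : Z →L[ℂ] U)
    (hA : StandingAssumption p ι Am G M)
    (μ : HistI → X →L[ℂ] X) (hμ : BoundedVariationOn μ univ)
    (hμ_cont : ContinuousAt μ zeroPt) (hμ_zero : μ zeroPt = 0)
    (ν : HistI → X →L[ℂ] U) (hν : BoundedVariationOn ν univ)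
    (hν_cont : ContinuousAt ν zeroPt) (hν_zero : ν zeroPt = 0)
    (P : W1p p X →L[ℂ] X) (hP : P = delayOp p μ hμ)
    (L : W1p p X →L[ℂ] U) (hL : L = delayOp p ν hν)
    (lam : ℂ) (hlam : lam ∈ rho (bdryOp ι Am G))
    (D : U →L[ℂ] Z) (hD : D = dirichletOp ι Am G lam)
    (hDM : (1 : ℂ) ∈ resolventSet ℂ (D ∘L M))
    (Δ : W1p p X →L[ℂ] W1p p X) (hΔ : Δ = charOp ι Am G M P L lam) :
    -- `Δ(lam)` is well defined, and its two expressions agree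
    (lam ∈ rho (bdryOp ι Am (G - M)) ∧
      IsDirichlet ι Am G lam D ∧
      IsDirichlet ι Am (G - M) lam (dirichletOp ι Am (G - M) lam) ∧
      dirichletOp ι Am (G - M) lam = Ring.inverse (1 - D ∘L M) ∘L D ∧
      (∀ u z, z = dirichletOp ι Am (G - M) lam u →
        lam • toExtrap (bdryOp ι Am G) lam (ι z) - extrapOp (bdryOp ι Am G) lam (ι z) =
          controlOp ι Am G lam (u + M z)) ∧
      ∃ RA : X →L[ℂ] Z, (∀ x, ι (RA x) = res (bdryOp ι Am G) lam x) ∧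
        Δ = expOp p lam ∘L ι ∘L Ring.inverse (1 - D ∘L M) ∘L (D ∘L L + RA ∘L P)) ∧
    -- the characteristic equation
    (lam ∈ rho (delayMatrix ι Am G M P L) ↔ (1 : ℂ) ∈ resolventSet ℂ Δ) ∧
    -- the resolvent; `RQ` is `R(lam, Q)` as an operator into its range in `W`
    ((1 : ℂ) ∈ resolventSet ℂ Δ →
      lam ∈ rho (shiftGen p X) ∧
      ∃ RQ : HistLp p X →L[ℂ] W1p p X,
        (∀ ψ, W1p.toLp (RQ ψ) = res (shiftGen p X) lam ψ) ∧
        ∃ (R₁₁ : X →L[ℂ] X) (R₁₂ : HistLp p X →L[ℂ] X)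
          (R₂₁ : X →L[ℂ] HistLp p X) (R₂₂ : HistLp p X →L[ℂ] HistLp p X),
          (∀ (x : X) (θ : HistI), R₁₁ x = Complex.exp (-lam * ((θ : ℝ) : ℂ)) •
            W1p.eval θ (Ring.inverse (1 - Δ)
              (expOp p lam (res (bdryOp ι Am (G - M)) lam x)))) ∧
          (∀ (ψ : HistLp p X) (θ : HistI), R₁₂ ψ = Complex.exp (-lam * ((θ : ℝ) : ℂ)) •
            W1p.eval θ (Δ (Ring.inverse (1 - Δ) (RQ ψ)))) ∧
          (∀ x : X, R₂₁ x = W1p.toLp (Ring.inverse (1 - Δ)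
            (expOp p lam (res (bdryOp ι Am (G - M)) lam x)))) ∧
          (∀ ψ : HistLp p X, R₂₂ ψ = W1p.toLp (Ring.inverse (1 - Δ) (RQ ψ))) ∧
          ∀ (x : X) (ψ : HistLp p X), res (delayMatrix ι Am G M P L) lam (x, ψ) =
            (R₁₁ x + R₁₂ ψ, R₂₁ x + R₂₂ ψ)) := by
  obtain ⟨S, hS⟩ := exists_isBdryResolvent hA.embedding hlam
  have hAm : Continuous Am := continuous_of_isClosed_range hA.closed hA.embedding
  have hDir : IsDirichlet ι Am G lam D := by
    obtain ⟨D', hD'⟩ := hS.exists_isDirichlet hAm hA.surjective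
    rw [hD, hD'.dirichletOp_eq]
    exact hD'
  have hu : IsUnit (1 - D ∘L M) := by
    simpa [spectrum.mem_resolventSet_iff] using hDM
  have hSM := hS.perturb hDir hu
  have hDirM := hDir.perturb hu
  set J : Z →L[ℂ] Z := Ring.inverse (1 - D ∘L M) with hJ
  have hRM := hSM.isResolventAt hA.embedding
  have hΔ' : ∀ φ, Δ φ = expOp p lam (ι ((J ∘L S) (P φ) + (J ∘L D) (L φ))) := fun φ => by
    rw [hΔ, charOp, hDirM.dirichletOp_eq, hRM.res_eq, map_add, add_comm (ι _)]
    rfl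
  have hmem : (1 : ℂ) ∈ resolventSet ℂ Δ ↔ IsUnit (1 - Δ) := by
    rw [spectrum.mem_resolventSet_iff, map_one]
  obtain ⟨RQ, hRQ⟩ := exists_histResolvent (X := X) p lam
  refine ⟨⟨⟨_, hRM⟩, hDir, ?_, hDirM.dirichletOp_eq, ?_, S, ?_, ?_⟩, ⟨?_, ?_⟩, ?_⟩
  · rw [hDirM.dirichletOp_eq]
    exact hDirM
  · rintro u z rfl
    rw [hDirM.dirichletOp_eq]
    -- With `z = J D u` one has `D (u + M z) = z`, so the identity in `X₋₁` becomes the definition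
    -- of `B (u + M z)`.
    have h1 : D (u + M ((J ∘L D) u)) = (J ∘L D) u := by
      have h2 := (inverse_apply_eq_iff hu (x := D u)).1 rfl
      change D u = (J ∘L D) u - D (M ((J ∘L D) u)) at h2
      rw [map_add, h2, sub_add_cancel]
    rw [controlOp, ← hD, h1]
  · intro x
    rw [(hS.isResolventAt hA.embedding).res_eq]
    rfl
  · ext1 φ
    rw [hΔ' φ]
    simp only [ContinuousLinearMap.comp_apply, map_add, _root_.add_apply]
    rw [add_comm]
  · rintro ⟨R, hR⟩
    rw [hmem]
    subst hL
    exact isUnit_one_sub_of_isResolventAt hA.embedding hSM hDirM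
      (tendsto_norm_delayOp_comp_expOp p hν hν_cont) hΔ' hR
  · intro h
    exact ⟨_, isResolventAt_delayResolvent hA.embedding hSM hDirM hRQ hΔ' (hmem.1 h)⟩
  · intro h
    have hΔu := hmem.1 h
    have hQ := isResolventAt_shiftGen hRQ
    have hR := isResolventAt_delayResolvent hA.embedding hSM hDirM hRQ hΔ' hΔu
    set T := Ring.inverse (1 - Δ) with hT
    have hTΔ : ∀ f, T f - Δ (T f) = f := fun f =>
      ((inverse_apply_eq_iff (E := W1p p X) hΔu (x := f)).1 rfl).symm
    have hexp : ∀ (x : X) (θ : HistI), x = Complex.exp (-lam * ((θ : ℝ) : ℂ)) •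
        W1p.eval θ (expOp p lam x) := fun x θ => by
      rw [W1p.eval_expOp, smul_smul, ← Complex.exp_add]
      simp
    let E : W1p p X →L[ℂ] X := ⟨W1p.eval zeroPt, W1p.continuous_eval zeroPt⟩
    let N : W1p p X →L[ℂ] HistLp p X := ⟨W1p.toLp, W1p.continuous_toLp⟩
    let V : X →L[ℂ] W1p p X := expOp p lam ∘L ι ∘L J ∘L S
    refine ⟨⟨_, hQ⟩, RQ, fun ψ => by rw [hQ.res_eq]; rfl,
      E ∘L T ∘L V, E ∘L T ∘L RQ, N ∘L T ∘L V, N ∘L T ∘L RQ, ?_, ?_, ?_, ?_, ?_⟩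
    · intro x θ
      rw [hRM.res_eq]
      -- `T V x = V x + Δ T V x` is a sum of two elements of the range of `e_lam`, so multiplication
      -- by `e_{-lam}` makes it constant.
      have h1 : ∃ y, T (V x) = expOp p lam y := by
        rw [← sub_add_cancel (T (V x)) (Δ (T (V x))), hTΔ, hΔ']
        exact ⟨_, (map_add (expOp p lam) _ _).symm⟩
      obtain ⟨y, hy⟩ := h1
      change W1p.eval zeroPt (T (V x)) = _ • W1p.eval θ (T (V x))
      rw [hy, W1p.eval_zeroPt_expOp]
      exact hexp y θ
    · intro ψ θ
      change W1p.eval zeroPt (T (RQ ψ)) = _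
      -- `T (RQ ψ)` and `Δ T (RQ ψ)` differ by `RQ ψ`, which vanishes at `0`; the latter function is
      -- a pure exponential. This is why `Δ` appears in `R₁₂`.
      have h1 : W1p.eval zeroPt (T (RQ ψ)) = W1p.eval zeroPt (Δ (T (RQ ψ))) := by
        rw [← sub_eq_zero, ← map_sub, hTΔ, (hRQ ψ).1]
      rw [h1, hΔ', W1p.eval_zeroPt_expOp]
      exact hexp _ θ
    · intro x
      rw [hRM.res_eq]
      rfl
    · exact fun ψ => rfl
    · intro x ψ
      rw [hR.res_eq, delayResolvent_apply, map_add, map_add, map_add]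
      rfl
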